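/- Let $n,\ell,k\ge 1$, and let $\mathcal X\subseteq[0,1]^\ell$ have diameter at most $1$ in the metric $\|x-y\|_1=\sum_{i}|x_i-y_i|$. A database is a tuple $D=(x_1,\dots,x_n)\in\mathcal X^n$; two databases are adjacent if they differ in at most one entry. A distance query is a point $y\in\mathcal X$, with exact answer $D(y)=\frac1n\sum_{j=1}^n\|x_j-y\|_1$. An interactive mechanism receives $k$ queries one after the other, each chosen by an analyst adaptively, as a (measurable) function of the earlier answers, and answers each query, using the database, its random coins and its state, before it sees the next one. It is $(\varepsilon,\delta)$-differentially private if for all adjacent $D,D'$, every analyst and every measurable set $S$ of transcripts (of $k$ queries and answers), $\Pr[\text{transcript on }D\in S]\le e^{\varepsilon}\Pr[\text{transcript on }D'\in S]+\delta$; it is $\varepsilon$-differentially private if this holds with $\delta=0$. It is $(\alpha,\beta)$-accurate if for every database and every analyst, with probability at least $1-\beta$, all $k$ answers are within $\alpha$ of the exact answers. Algorithms are programs of a randomized real RAM: memories of natural numbers and of real numbers with indirect addressing, read-only access to the database, to the current query and to an array of independent uniform random reals in $[0,1]$; unit cost for each load or store, addition and (truncated) subtraction of natural numbers, field operation, $\exp$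 and $\log$ on reals, conversion of a natural number to a real, comparison, and read of the database, the query or the random array; reals cannot be rounded to integers. The numbers $n,\ell,k,\varepsilon,\delta,\beta$ are given to the program, and the memories persist from query to query. (1) There are a program and absolute constants $C,K>0$ such that for all $n,\ell,k\ge1$, $\varepsilon>0$, $\delta,\beta\in(0,1)$ and all $\mathcal X$ as above, the interactive mechanism given by the program is $(\varepsilon,\delta)$-differentially private, is $(\alpha,\beta)$-accurate with $$\alpha= C\cdot\frac{\ell^{9/5}\,\log^{4/5}(4/\delta)\,\log^{4/5}(k/\beta)}{n^{4/5}\,\varepsilon^{4/5}},$$ and answers each query in at most $K\ell n$ steps. (2) There are a program and absolute constants $C,K>0$ such that for all $n,\ell,k\ge1$, $\varepsilon>0$, $\beta\in(0,1)$ and all $\mathcal X$ as above, the interactive mechanism given by the program is $\varepsilon$-differentially private, is $(\alpha,\beta)$-accurate with $$\alpha= C\cdot\frac{\ell^{7/3}\,\log^{2/3}(k/\beta)}{n^{2/3}\,\varepsilon^{2/3}},$$ and answers each query in at most $K\ell n$ steps. -/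

import Mathlib

open MeasureTheory

noncomputable section

/-! ### Points, databases and distance queries -/

/-- `ℝ^ℓ` with the `ℓ₁` metric `‖x - y‖₁ = ∑ i, |x i - y i|`. -/
abbrev L1Space (ℓ : ℕ) : Type := PiLp 1 (fun _ : Fin ℓ => ℝ)

/-- The cube `[0,1]^ℓ`. -/
def unitCube (ℓ : ℕ) : Set (L1Space ℓ) := {x | ∀ i, x i ∈ Set.Icc (0 : ℝ) 1}

/-- The exact answer to the distance query `y` on the database `D`: the average distance from `y`
to the points of `D`. -/
def distanceAnswer {n : ℕ} {Y : Type} [Dist Y] (D : Fin n → Y) (y : Y) : ℝ :=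
  (1 / (n : ℝ)) * ∑ j, dist (D j) y

/-- Two databases of the same size are adjacent if they differ in at most one element. -/
def Adjacent {n : ℕ} {Y : Type} [DecidableEq Y] (D D' : Fin n → Y) : Prop :=
  hammingDist D D' ≤ 1

/-! ### Interactive mechanisms, privacy and accuracy -/

/-- A data analyst with queries in `X`: the query asked in round `j` is chosen adaptively,
as a measurable function of the answers received in the rounds before it.
(The earlier queries are themselves determined by the earlier answers.) -/
structure Analyst {Y : Type} [MeasurableSpace Y] (X : Set Y) where
  ask : (j : ℕ) → (Fin j → ℝ) → Y
  ask_mem : ∀ j a, ask j a ∈ X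
  measurable_ask : ∀ j, Measurable (ask j)

/-- An interactive mechanism on databases of `n` points of `Y`, with random coins in `Ω`. It
keeps a state; the answer to a query depends on the database, the coins, the current
state and the query, but not on future queries. -/
structure InteractiveMechanism (n : ℕ) (Y Ω : Type) where
  State : Type
  start : State
  respond : (Fin n → Y) → Ω → State → Y → State
  answer : State → ℝ

namespace InteractiveMechanism

variable {n : ℕ} {Y Ω : Type} [MeasurableSpace Y] [MeasurableSpace Ω]

/-- The state of the mechanism and the list of answers after `j` rounds. -/
def play (M : InteractiveMechanism n Y Ω) {X : Set Y} (D : Fin n → Y) (A : Analyst X) (ω : Ω) :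
    (j : ℕ) → M.State × (Fin j → ℝ)
  | 0 => (M.start, Fin.elim0)
  | j + 1 =>
    let s := M.play D A ω j
    let s' := M.respond D ω s.1 (A.ask j s.2)
    (s', Fin.snoc s.2 (M.answer s'))

/-- The query asked in round `j`. -/
def queryAt (M : InteractiveMechanism n Y Ω) {X : Set Y} (D : Fin n → Y) (A : Analyst X) (ω : Ω)
    (j : ℕ) : Y :=
  A.ask j (M.play D A ω j).2

/-- The answer given in round `j`. -/
def answerAt (M : InteractiveMechanism n Y Ω) {X : Set Y} (D : Fin n → Y) (A : Analyst X) (ω : Ω)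
    (j : ℕ) : ℝ :=
  M.answer (M.play D A ω (j + 1)).1

/-- The transcript of queries and answers in `k` rounds. -/
def transcript (M : InteractiveMechanism n Y Ω) {X : Set Y} (k : ℕ) (D : Fin n → Y)
    (A : Analyst X) (ω : Ω) : Fin k → Y × ℝ :=
  fun j => (M.queryAt D A ω j, M.answerAt D A ω j)

/-- `(ε, δ)`-differential privacy for `k` adaptively chosen queries from `X` and databases in
`X^n`; the coins of the mechanism have law `μ`. -/
def IsDifferentiallyPrivate [DecidableEq Y] (M : InteractiveMechanism n Y Ω) (μ : Measure Ω)
    (X : Set Y) (k : ℕ) (ε δ : ℝ) : Prop :=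
  ∀ D D' : Fin n → Y, (∀ i, D i ∈ X) → (∀ i, D' i ∈ X) → Adjacent D D' →
    ∀ A : Analyst X, ∀ S : Set (Fin k → Y × ℝ), MeasurableSet S →
      μ {ω | M.transcript k D A ω ∈ S} ≤
        ENNReal.ofReal (Real.exp ε) * μ {ω | M.transcript k D' A ω ∈ S} + ENNReal.ofReal δ

/-- `(α, β)`-accuracy for `k` adaptively chosen distance queries from `X` and databases in `X^n`:
the probability that some answer has an additive error greater than `α` is at most `β`. -/
def IsAccurate [Dist Y] (M : InteractiveMechanism n Y Ω) (μ : Measure Ω)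
    (X : Set Y) (k : ℕ) (α β : ℝ) : Prop :=
  ∀ D : Fin n → Y, (∀ i, D i ∈ X) → ∀ A : Analyst X,
    μ {ω | ∃ j : Fin k,
      α < |M.answerAt D A ω j - distanceAnswer D (M.queryAt D A ω j)|} ≤ ENNReal.ofReal β

end InteractiveMechanism

/-! ### Randomized real RAM programs, with unit cost per instruction

The machine has a memory of natural numbers `N[0], N[1], …` and a memory of real numbers
`R[0], R[1], …`, both with indirect addressing. It has read-only access to the database, to the
current query and to an array of random reals. Reals can be compared and combined by field
operations, `exp` and `log`, but cannot be rounded or used as addresses. -/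

/-- The random array: a sequence of reals in `[0,1]`. -/
abbrev RandomTape : Type := ℕ → unitInterval

/-- The entries of the random array are independent and uniform on `[0,1]`. -/
def tapeLaw : Measure RandomTape := Measure.infinitePi fun _ => volume

/-- What a program reads but cannot change. -/
structure RamInput (n ℓ : ℕ) where
  data : Fin n → L1Space ℓ
  query : L1Space ℓ
  tape : RandomTape

/-- The two memories. -/
structure RamState where
  nat : ℕ → ℕ
  real : ℕ → ℝ

def RamState.setNat (s : RamState) (a v : ℕ) : RamState :=
  { s with nat := Function.update s.nat a v }

def RamState.setReal (s : RamState) (a : ℕ) (v : ℝ) : RamState :=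
  { s with real := Function.update s.real a v }

/-- The instructions; the arguments are fixed addresses, except that the last argument of
`natConst` and of `realConst` is the constant itself. -/
inductive RamInstr where
  | natConst (d c : ℕ)
  | natAdd (d a b : ℕ)
  | natSub (d a b : ℕ)
  | natLoad (d a : ℕ)
  | natStore (a b : ℕ)
  | realConst (d : ℕ) (c : ℚ)
  | realOfNat (d a : ℕ)
  | realAdd (d a b : ℕ)
  | realSub (d a b : ℕ)
  | realMul (d a b : ℕ)
  | realDiv (d a b : ℕ)
  | realExp (d a : ℕ)
  | realLog (d a : ℕ)
  | realLoad (d a : ℕ)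
  | realStore (a b : ℕ)
  | loadData (d a b : ℕ)
  | loadQuery (d a : ℕ)
  | loadRandom (d a : ℕ)

/-- The effect of an instruction. `natLoad`, `realLoad`, `loadRandom` read the cell whose number is
stored in `N[a]`, and `natStore`, `realStore` write to that cell. `loadData` reads the coordinate
number `N[b]` of the database point number `N[a]`, and `loadQuery` the coordinate number `N[a]` of
the query (both read `0` outside the range). -/
def RamInstr.exec {n ℓ : ℕ} (E : RamInput n ℓ) (s : RamState) : RamInstr → RamState
  | natConst d c => s.setNat d c
  | natAdd d a b => s.setNat d (s.nat a + s.nat b)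
  | natSub d a b => s.setNat d (s.nat a - s.nat b)
  | natLoad d a => s.setNat d (s.nat (s.nat a))
  | natStore a b => s.setNat (s.nat a) (s.nat b)
  | realConst d c => s.setReal d c
  | realOfNat d a => s.setReal d (s.nat a)
  | realAdd d a b => s.setReal d (s.real a + s.real b)
  | realSub d a b => s.setReal d (s.real a - s.real b)
  | realMul d a b => s.setReal d (s.real a * s.real b)
  | realDiv d a b => s.setReal d (s.real a / s.real b)
  | realExp d a => s.setReal d (Real.exp (s.real a))
  | realLog d a => s.setReal d (Real.log (s.real a))
  | realLoad d a => s.setReal d (s.real (s.nat a))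
  | realStore a b => s.setReal (s.nat a) (s.real b)
  | loadData d a b => s.setReal d
      (if h : s.nat a < n ∧ s.nat b < ℓ then E.data ⟨s.nat a, h.1⟩ ⟨s.nat b, h.2⟩ else 0)
  | loadQuery d a => s.setReal d
      (if h : s.nat a < ℓ then E.query ⟨s.nat a, h⟩ else 0)
  | loadRandom d a => s.setReal d (E.tape (s.nat a) : ℝ)

/-- The tests on which a program can branch: `N[a] < N[b]` and `R[a] < R[b]`. -/
inductive RamTest where
  | natLt (a b : ℕ)
  | realLt (a b : ℕ)

def RamTest.Holds (s : RamState) : RamTest → Prop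
  | natLt a b => s.nat a < s.nat b
  | realLt a b => s.real a < s.real b

/-- Programs: instructions, sequencing, branching, and loops (`loop t p` is `while t do p`). -/
inductive RamProgram where
  | instr (i : RamInstr)
  | seq (p q : RamProgram)
  | branch (t : RamTest) (p q : RamProgram)
  | loop (t : RamTest) (p : RamProgram)

/-- A configuration is the list of programs that remain to be executed, with the memories. -/
abbrev RamConfig : Type := List RamProgram × RamState

open Classical in
/-- One step of the computation. The machine has halted when nothing remains to be executed. -/
def ramStep {n ℓ : ℕ} (E : RamInput n ℓ) : RamConfig → RamConfig
  | ([], s) => ([], s)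
  | (.instr i :: K, s) => (K, i.exec E s)
  | (.seq p q :: K, s) => (p :: q :: K, s)
  | (.branch t p q :: K, s) => if t.Holds s then (p :: K, s) else (q :: K, s)
  | (.loop t p :: K, s) => if t.Holds s then (p :: .loop t p :: K, s) else (K, s)

namespace RamProgram

/-- The configuration after `m` steps, starting the program `P` with the memories `s`. -/
def configAfter {n ℓ : ℕ} (P : RamProgram) (E : RamInput n ℓ) (s : RamState) (m : ℕ) : RamConfig :=
  (ramStep E)^[m] ([P], s)

/-- The number of steps until `P` halts; it is `⊤` if `P` runs forever. -/
def runningTime {n ℓ : ℕ} (P : RamProgram) (E : RamInput n ℓ) (s : RamState) : ℕ∞ :=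
  sInf {m : ℕ∞ | ∃ r : ℕ, m = r ∧ (P.configAfter E s r).1 = []}

/-- The memories when `P` halts (relevant only if it does halt). -/
def finalState {n ℓ : ℕ} (P : RamProgram) (E : RamInput n ℓ) (s : RamState) : RamState :=
  (P.configAfter E s (P.runningTime E s).toNat).2

end RamProgram

/-- The public parameters of a query release mechanism: the size `n` of the database, the dimension
`ℓ`, the number `k` of queries, the privacy parameters `ε`, `δ`, and the failure
probability `β`. -/
structure ReleaseParams where
  n : ℕ
  ℓ : ℕ
  k : ℕ
  ε : ℝ
  δ : ℝ
  β : ℝ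

/-- The memories before the first query: the parameters, and `0` elsewhere. -/
def ReleaseParams.initialState (p : ReleaseParams) : RamState where
  nat a := if a = 0 then p.n else if a = 1 then p.ℓ else if a = 2 then p.k else 0
  real a := if a = 0 then p.ε else if a = 1 then p.δ else if a = 2 then p.β else 0

namespace RamProgram

/-- The interactive mechanism that runs the program once for every query. The memories
persist from query to query, and the answer is found in `R[3]` when the program halts. -/
def mechanism (P : RamProgram) (p : ReleaseParams) :
    InteractiveMechanism p.n (L1Space p.ℓ) RandomTape where
  State := RamState
  start := p.initialState
  respond D ω s y := P.finalState ⟨D, y, ω⟩ s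
  answer s := s.real 3

/-- For databases and queries from `X`, each one of the `k` queries is answered in at most `T`
steps (for all values of the random array). -/
def AnswersInTime (P : RamProgram) (p : ReleaseParams) (X : Set (L1Space p.ℓ)) (T : ℕ) : Prop :=
  ∀ D : Fin p.n → L1Space p.ℓ, (∀ i, D i ∈ X) → ∀ (A : Analyst X) (ω : RandomTape),
    ∀ j < p.k,
      P.runningTime ⟨D, (P.mechanism p).queryAt D A ω j, ω⟩ ((P.mechanism p).play D A ω j).1 ≤ T

end RamProgram

end

open scoped ENNReal NNReal

/-! ### Comparison of measures -/

/-! One program serves both parts. It is purely `ε`-private, and with `t = log (k / β) / (n ε)` its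
error is `O(ℓ (1 + log ℓ) log³(4 / t) t)` for `t ≤ 1`, hence `O(ℓ^(9/5) t^(4/5))`. This gives (1)
since `log (4 / δ) ≥ 1`, and (2) since both exponents change in the right direction; for `t > 1`
clipping the answers to `[0,1]` is enough.

The exact answer is a sum of one function of `y i` per coordinate. Each coordinate gets a binary
tree of dyadic points with a noise variable at every node. A query is rounded down to a dyadic
point, and the noise on the path to that point is added to the exact value there. Replacing `x` by
`x'` in the database changes the part of coordinate `i` by `(|x i - y i| - |x' i - y i|) / n`, a
monotone function of `y i` (up to sign) bounded by `|x i - x' i| / n`. Give every node the value of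
this function at its point minus the value at its parent's point: path sums telescope to the change,
and each level has total size at most `2 |x i - x' i| / n`. So with `d` levels and noise of scale `2
d / (n ε)`, a shift of the noise of `ℓ₁` norm at most `ε` turns all answers on `D` into those on
`D'` at once (`exists_shift_tree`). Such a shift of logistic noise costs a factor `e ^ ε`
(`tapeLaw_le_of_shift`), and adaptivity is harmless because the answers are a fixed function of
database, noise and query (`isDifferentiallyPrivate_of_shift`).

Accuracy is a union bound over all nodes (`exists_noise_bound`): with `d` of order `log (4 / t)` the
exponential number of nodes costs only one more logarithm. The trees are never stored, since the
noise of a node is read from a cell of the random array, so a path costs `O(d)` steps. Two cases are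
separate: for `t < e^(-n)` the depth would be too large for the time bound, but noise of scale `1 /
ε` on the data is accurate enough; for `k = 1`, `log (k / β)` can be arbitrarily small, and one
noise of scale `1 / (n ε)` is used. -/

theorem measure_le_of_forall_mem_setAlgebra {Ω : Type*} [m : MeasurableSpace Ω] {𝒜 : Set (Set Ω)}
    (h𝒜 : IsSetAlgebra 𝒜) (hgen : m = MeasurableSpace.generateFrom 𝒜) {μ ν : Measure Ω}
    [IsFiniteMeasure μ] [IsFiniteMeasure ν] (c : ℝ≥0) (h : ∀ s ∈ 𝒜, ν s ≤ c * μ s) :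
    ν ≤ (c : ℝ≥0∞) • μ := by
  refine Measure.le_iff.2 fun s hs => ?_
  rw [Measure.smul_apply, smul_eq_mul]
  refine ENNReal.le_of_forall_pos_le_add fun η hη _ => ?_
  -- Approximating `s` costs `d` once for `ν` and `c` times for `μ`, in total `η`; approximation
  -- with respect to `μ + ν` makes one `t` serve both.
  set d : ℝ≥0 := η / (1 + c)
  have hd : 0 < (d : ℝ) := by positivity
  obtain ⟨t, ht, hst⟩ := (Measure.MeasureDense.of_generateFrom_isSetAlgebra_finite (μ + ν) h𝒜
    hgen).approx s hs (measure_ne_top _ _) d hd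
  rw [ENNReal.ofReal_coe_nnreal, Measure.add_apply] at hst
  have hμ : μ t ≤ μ s + d := by
    calc μ t ≤ μ (s ∪ symmDiff s t) := by
          refine measure_mono fun x hx => ?_
          by_cases hxs : x ∈ s
          · exact Or.inl hxs
          · exact Or.inr (Or.inr ⟨hx, hxs⟩)
      _ ≤ μ s + μ (symmDiff s t) := measure_union_le _ _
      _ ≤ μ s + d := by gcongr; exact (le_self_add).trans hst.le
  have hν : ν s ≤ ν t + d := by
    calc ν s ≤ ν (t ∪ symmDiff s t) := by
          refine measure_mono fun x hx => ?_
          by_cases hxt : x ∈ t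
          · exact Or.inl hxt
          · exact Or.inr (Or.inl ⟨hx, hxt⟩)
      _ ≤ ν t + ν (symmDiff s t) := measure_union_le _ _
      _ ≤ ν t + d := by gcongr; exact (le_add_self).trans hst.le
  calc ν s ≤ ν t + d := hν
    _ ≤ c * (μ s + d) + d := by gcongr; exact (h t ht).trans (by gcongr)
    _ = c * μ s + ((1 + c) * d : ℝ≥0) := by push_cast; ring
    _ = c * μ s + η := by
      congr 2
      simp only [d]
      field_simp

theorem pi_le_smul_pi {ι : Type*} [Fintype ι] {Y : ι → Type*} [∀ i, MeasurableSpace (Y i)]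
    {μ ν : ∀ i, Measure (Y i)} [∀ i, IsFiniteMeasure (μ i)] [∀ i, IsFiniteMeasure (ν i)]
    (K : ι → ℝ≥0) (h : ∀ i, ν i ≤ (K i : ℝ≥0∞) • μ i) :
    Measure.pi ν ≤ ((∏ i, K i : ℝ≥0) : ℝ≥0∞) • Measure.pi μ := by
  have e : Measure.pi (fun i => K i • μ i) = ((∏ i, K i : ℝ≥0) : ℝ≥0∞) • Measure.pi μ := by
    refine Measure.pi_eq fun s _ => ?_
    rw [Measure.smul_apply, smul_eq_mul, Measure.pi_pi, ENNReal.ofNNReal_finsetProd,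
      ← Finset.prod_mul_distrib]
    rfl
  rw [← e]
  -- The product outer measure is the largest one dominated by products on boxes, so only boxes need
  -- checking.
  have : (Measure.pi ν).toOuterMeasure ≤ OuterMeasure.pi fun i => (K i • μ i).toOuterMeasure := by
    refine OuterMeasure.le_pi.2 fun s _ => ?_
    change Measure.pi ν _ ≤ _
    rw [Measure.pi_pi]
    refine Finset.prod_le_prod' fun i _ => h i _
  intro s
  refine (this s).trans ?_
  rw [Measure.pi]
  exact le_toMeasure_apply _ _ _

theorem infinitePi_le_smul_infinitePi {ι : Type*} {Y : ι → Type*} [∀ i, MeasurableSpace (Y i)]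
    {μ ν : ∀ i, Measure (Y i)} [∀ i, IsProbabilityMeasure (μ i)]
    [∀ i, IsProbabilityMeasure (ν i)] (K : ι → ℝ≥0) (h : ∀ i, ν i ≤ (K i : ℝ≥0∞) • μ i) (c : ℝ≥0)
    (hc : ∀ s : Finset ι, ∏ i ∈ s, K i ≤ c) :
    Measure.infinitePi ν ≤ (c : ℝ≥0∞) • Measure.infinitePi μ := by
  refine measure_le_of_forall_mem_setAlgebra isSetAlgebra_measurableCylinders
    generateFrom_measurableCylinders.symm c fun A hA => ?_
  obtain ⟨s, S, hS, rfl⟩ := (mem_measurableCylinders A).1 hA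
  rw [Measure.infinitePi_cylinder ν hS, Measure.infinitePi_cylinder μ hS]
  refine (pi_le_smul_pi (fun i : s => K i) (fun i => h i) S).trans ?_
  rw [Measure.smul_apply, smul_eq_mul]
  gcongr
  rw [Finset.prod_coe_sort s K]
  exact hc s

/-! ### Logistic noise -/

/-- The quantile function of the logistic distribution. -/
noncomputable def logit (u : ℝ) : ℝ := Real.log (u / (1 - u))

/-- The map of `[0,1]` that corresponds to a translation by `c` of the logistic distribution. -/
noncomputable def tilt (c u : ℝ) : ℝ := u * Real.exp c / (1 - u + u * Real.exp c)

theorem tilt_denom_pos (c : ℝ) {u : ℝ} (hu : u ∈ Set.Icc (0 : ℝ) 1) :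
    0 < 1 - u + u * Real.exp c := by
  obtain ⟨h0, h1⟩ := hu
  rcases h0.eq_or_lt with rfl | h
  · norm_num
  · have := mul_pos h (Real.exp_pos c)
    linarith

theorem tilt_mem (c : ℝ) {u : ℝ} (hu : u ∈ Set.Icc (0 : ℝ) 1) : tilt c u ∈ Set.Icc (0 : ℝ) 1 := by
  have hd := tilt_denom_pos c hu
  refine ⟨div_nonneg (mul_nonneg hu.1 (Real.exp_pos c).le) hd.le, ?_⟩
  rw [tilt, div_le_one hd]
  linarith [hu.2]

theorem tilt_neg_tilt (c : ℝ) {u : ℝ} (hu : u ∈ Set.Icc (0 : ℝ) 1) : tilt (-c) (tilt c u) = u := by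
  have hd := tilt_denom_pos c hu
  have hc := Real.exp_pos c
  have e : 1 - tilt c u = (1 - u) / (1 - u + u * Real.exp c) := by
    rw [tilt, eq_div_iff hd.ne', sub_mul, div_mul_cancel₀ _ hd.ne']
    ring
  have e2 : tilt c u * Real.exp (-c) = u / (1 - u + u * Real.exp c) := by
    rw [tilt, Real.exp_neg]
    field_simp
  rw [tilt, e, e2, ← add_div, sub_add_cancel, div_div_div_cancel_right₀ hd.ne', div_one]

theorem logit_tilt (c : ℝ) {u : ℝ} (h0 : 0 < u) (h1 : u < 1) :
    logit (tilt c u) = logit u + c := by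
  have hd := tilt_denom_pos c (u := u) ⟨h0.le, h1.le⟩
  have hc := Real.exp_pos c
  have e : 1 - tilt c u = (1 - u) / (1 - u + u * Real.exp c) := by
    rw [tilt, eq_div_iff hd.ne', sub_mul, div_mul_cancel₀ _ hd.ne']
    ring
  have h1' : 0 < 1 - u := by linarith
  rw [logit, e, tilt, div_div_div_cancel_right₀ hd.ne', mul_div_right_comm,
    Real.log_mul (by positivity) hc.ne', Real.log_exp, logit]

/-- The difference quotient of this Möbius map is `e^c` over the product of two denominators, each
at least `min 1 (e^c)`. -/
theorem tilt_lipschitz (c : ℝ) :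
    LipschitzOnWith (Real.toNNReal (Real.exp |c|)) (tilt c) (Set.Icc 0 1) := by
  refine LipschitzOnWith.of_dist_le_mul fun u hu v hv => ?_
  have hu' := tilt_denom_pos c hu
  have hv' := tilt_denom_pos c hv
  rw [Real.coe_toNNReal _ (Real.exp_pos _).le, Real.dist_eq, Real.dist_eq]
  have e : tilt c u - tilt c v = Real.exp c * (u - v) /
      ((1 - u + u * Real.exp c) * (1 - v + v * Real.exp c)) := by
    rw [tilt, tilt, div_sub_div _ _ hu'.ne' hv'.ne']
    congr 1
    ring
  rw [e, abs_div, abs_mul, Real.abs_exp, abs_of_pos (mul_pos hu' hv'), div_le_iff₀ (mul_pos hu' hv')]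
  have key : Real.exp c ≤ Real.exp |c| * ((1 - u + u * Real.exp c) * (1 - v + v * Real.exp c)) := by
    rcases le_total 0 c with h | h
    · rw [abs_of_nonneg h]
      have hexp : 1 ≤ Real.exp c := Real.one_le_exp h
      have a : 1 ≤ 1 - u + u * Real.exp c := by nlinarith [hu.1]
      have b : 1 ≤ 1 - v + v * Real.exp c := by nlinarith [hv.1]
      exact le_mul_of_one_le_right (Real.exp_pos c).le (one_le_mul_of_one_le_of_one_le a b)
    · rw [abs_of_nonpos h]
      have hexp : Real.exp c ≤ 1 := Real.exp_le_one_iff.2 h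
      have a : Real.exp c ≤ 1 - u + u * Real.exp c := by nlinarith [hu.2]
      have b : Real.exp c ≤ 1 - v + v * Real.exp c := by nlinarith [hv.2]
      calc Real.exp c = Real.exp (-c) * (Real.exp c * Real.exp c) := by
            rw [← Real.exp_add, ← Real.exp_add]
            congr 1
            ring
        _ ≤ _ := by gcongr
  calc Real.exp c * |u - v| ≤ Real.exp |c| *
        ((1 - u + u * Real.exp c) * (1 - v + v * Real.exp c)) * |u - v| := by gcongr
    _ = _ := by ring

/-- `tilt` as a self-map of the unit interval. -/
noncomputable def unitTilt (c : ℝ) (u : unitInterval) : unitInterval :=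
  ⟨tilt c u, tilt_mem c u.2⟩

theorem measurable_unitTilt (c : ℝ) : Measurable (unitTilt c) := by
  refine Measurable.subtype_mk ?_
  unfold tilt
  fun_prop

/-- Preimages under `tilt c` are images under its Lipschitz inverse `tilt (-c)`, which expands
length, as one-dimensional Hausdorff measure, by at most its Lipschitz constant. -/
theorem map_unitTilt_le (c : ℝ) :
    (volume : Measure unitInterval).map (unitTilt c) ≤
      ((Real.toNNReal (Real.exp |c|) : ℝ≥0) : ℝ≥0∞) • volume := by
  refine Measure.le_iff.2 fun s hs => ?_
  rw [Measure.map_apply (measurable_unitTilt c) hs, Measure.smul_apply, smul_eq_mul,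
    unitInterval.volume_apply, unitInterval.volume_apply]
  have hsub : (Subtype.val '' s : Set ℝ) ⊆ Set.Icc 0 1 := by
    rintro _ ⟨u, _, rfl⟩
    exact u.2
  have himg : (Subtype.val '' (unitTilt c ⁻¹' s) : Set ℝ) ⊆ tilt (-c) '' (Subtype.val '' s) := by
    rintro _ ⟨u, hu, rfl⟩
    exact ⟨tilt c u, ⟨_, hu, rfl⟩, tilt_neg_tilt c u.2⟩
  refine (measure_mono himg).trans ?_
  have := ((tilt_lipschitz (-c)).mono hsub).hausdorffMeasure_image_le (d := 1) zero_le_one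
  rw [hausdorffMeasure_real, abs_neg] at this
  simpa using this

/-- The tail `2 / (1 + e^s)` is weakened by AM-GM to a bound without a constant in front: for one
cell, `s = 2 log (1 / β)` then gives exactly `β`, also for `β` near `1`. -/
theorem volume_logit_tail (s : ℝ) :
    (volume : Measure unitInterval) {u | s < |logit u|} ≤ ENNReal.ofReal (Real.exp (-s / 2)) := by
  set q : ℝ := 1 / (1 + Real.exp s)
  have hE := Real.exp_pos s
  have hq : 0 < q := by positivity
  rw [unitInterval.volume_apply]
  have hsub : (Subtype.val '' {u : unitInterval | s < |logit u|} : Set ℝ) ⊆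
      Set.Icc 0 q ∪ Set.Icc (1 - q) 1 := by
    rintro _ ⟨⟨u, h0, h1⟩, hu, rfl⟩
    change s < |logit u| at hu
    change u ∈ _
    rcases h0.eq_or_lt with rfl | h0
    · exact Or.inl ⟨le_rfl, hq.le⟩
    rcases h1.eq_or_lt with rfl | h1
    · exact Or.inr ⟨by linarith, le_rfl⟩
    have h1' : 0 < 1 - u := by linarith
    rw [logit] at hu
    rcases lt_abs.1 hu with h | h
    · rw [Real.lt_log_iff_exp_lt (by positivity), lt_div_iff₀ h1'] at h
      refine Or.inr ⟨?_, h1.le⟩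
      have : 1 - q = Real.exp s / (1 + Real.exp s) := by simp only [q]; field_simp; ring
      rw [this, div_le_iff₀ (by positivity)]
      linarith
    · rw [← Real.log_inv, Real.lt_log_iff_exp_lt (by positivity), inv_div, lt_div_iff₀ h0] at h
      refine Or.inl ⟨h0.le, ?_⟩
      rw [le_div_iff₀ (by positivity)]
      linarith
  refine (measure_mono hsub).trans ((measure_union_le _ _).trans ?_)
  rw [Real.volume_Icc, Real.volume_Icc, ← ENNReal.ofReal_add (by linarith) (by linarith)]
  refine ENNReal.ofReal_le_ofReal ?_
  have h2 : Real.exp s = Real.exp (s / 2) * Real.exp (s / 2) := by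
    rw [← Real.exp_add]
    congr 1
    ring
  have h3 : 2 * Real.exp (s / 2) ≤ 1 + Real.exp s := by
    rw [h2]
    nlinarith [sq_nonneg (Real.exp (s / 2) - 1)]
  rw [neg_div, Real.exp_neg, sub_zero, sub_sub_cancel, ← two_mul, inv_eq_one_div]
  simp only [q]
  rw [mul_one_div, div_le_div_iff₀ (by positivity) (by positivity)]
  linarith

/-- The noise drawn from cell `a` of the random array. -/
noncomputable def noise (ω : RandomTape) (a : ℕ) : ℝ := logit (ω a)

instance : IsProbabilityMeasure tapeLaw := by
  unfold tapeLaw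
  infer_instance

theorem tapeLaw_noise_tail (a : ℕ) (s : ℝ) :
    tapeLaw {ω | s < |noise ω a|} ≤ ENNReal.ofReal (Real.exp (-s / 2)) := by
  refine le_trans ?_ (volume_logit_tail s)
  rw [← Measure.infinitePi_map_eval (fun _ : ℕ => (volume : Measure unitInterval)) a]
  exact Measure.le_map_apply (measurable_pi_apply a).aemeasurable _

theorem tapeLaw_exists_noise_gt (M : ℕ) {β : ℝ} (hβ : 0 < β) (hM : 0 < M) :
    tapeLaw {ω | ∃ a < M, 2 * Real.log (M / β) < |noise ω a|} ≤ ENNReal.ofReal β := by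
  have hM0 : 0 < (M : ℝ) := Nat.cast_pos.2 hM
  have hsub : {ω : RandomTape | ∃ a < M, 2 * Real.log (M / β) < |noise ω a|} =
      ⋃ a ∈ Finset.range M, {ω | 2 * Real.log (M / β) < |noise ω a|} := by
    ext ω
    simp
  rw [hsub]
  refine (measure_biUnion_finset_le _ _).trans ?_
  refine (Finset.sum_le_sum fun a _ => tapeLaw_noise_tail a _).trans ?_
  rw [Finset.sum_const, Finset.card_range, nsmul_eq_mul, ← ENNReal.ofReal_natCast,
    ← ENNReal.ofReal_mul (by positivity)]
  refine ENNReal.ofReal_le_ofReal (le_of_eq ?_)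
  rw [show -(2 * Real.log (M / β)) / 2 = -Real.log (M / β) by ring, Real.exp_neg,
    Real.exp_log (by positivity)]
  field_simp

/-- Shifting the noise of each cell `a` by `c a` changes the law of the random array by a factor of
at most `e ^ ε` if `∑ |c a| ≤ ε`. -/
theorem tapeLaw_le_of_shift {ε : ℝ} (c : ℕ → ℝ) (hc : ∀ s : Finset ℕ, ∑ a ∈ s, |c a| ≤ ε)
    (E E' : Set RandomTape)
    (h : ∀ ω ω' : RandomTape, (∀ a, noise ω' a = noise ω a + c a) → ω ∈ E → ω' ∈ E') :
    tapeLaw E ≤ ENNReal.ofReal (Real.exp ε) * tapeLaw E' := by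
  set T : RandomTape → RandomTape := fun ω a => unitTilt (c a) (ω a)
  have hTa : ∀ a, Measurable (unitTilt (c a)) := fun a => measurable_unitTilt _
  have hT : Measurable T := measurable_pi_lambda _ fun a => (hTa a).comp (measurable_pi_apply a)
  -- Only almost everywhere: `logit` takes the junk value `0` at `0` and `1`.
  have hae : ∀ᵐ ω ∂tapeLaw, ∀ a, noise (T ω) a = noise ω a + c a := by
    refine ae_all_iff.2 fun a => ?_
    have h0 : ∀ b : unitInterval, ∀ᵐ ω ∂tapeLaw, ω a ≠ b := by
      intro b
      have hb : ∀ᵐ u ∂(volume : Measure unitInterval), u ≠ b := by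
        simp [ae_iff]
      rw [← Measure.infinitePi_map_eval (fun _ : ℕ => (volume : Measure unitInterval)) a] at hb
      exact ae_of_ae_map (measurable_pi_apply a).aemeasurable hb
    filter_upwards [h0 0, h0 1] with ω h0 h1
    exact logit_tilt _ (unitInterval.pos_iff_ne_zero.2 h0) (unitInterval.lt_one_iff_ne_one.2 h1)
  have hmap : tapeLaw.map T ≤ ((Real.toNNReal (Real.exp ε) : ℝ≥0) : ℝ≥0∞) • tapeLaw := by
    have hp : ∀ a, IsProbabilityMeasure ((volume : Measure unitInterval).map (unitTilt (c a))) :=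
      fun a => Measure.isProbabilityMeasure_map (hTa a).aemeasurable
    rw [tapeLaw]
    have := Measure.infinitePi_map_pi (μ := fun _ : ℕ => (volume : Measure unitInterval)) hTa
    rw [this]
    refine infinitePi_le_smul_infinitePi (fun a => Real.toNNReal (Real.exp |c a|))
      (fun a => map_unitTilt_le (c a)) _ fun s => ?_
    rw [← Real.toNNReal_prod_of_nonneg (fun a _ => (Real.exp_pos _).le), ← Real.exp_sum]
    exact Real.toNNReal_le_toNNReal (Real.exp_le_exp.2 (hc s))
  calc tapeLaw E ≤ tapeLaw (T ⁻¹' E') := by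
        refine measure_mono_ae ?_
        filter_upwards [hae] with ω hω hE
        exact h ω (T ω) hω hE
    _ ≤ tapeLaw.map T E' := Measure.le_map_apply hT.aemeasurable _
    _ ≤ _ := hmap E'

/-! ### A program logic with step counts -/

namespace RamProgram

variable {n ℓ : ℕ} {E : RamInput n ℓ}

/-- `P`, started with the memories `s`, halts after at most `B` steps with memories that satisfy
`Q`, whatever remains to be executed afterwards. -/
def Runs (E : RamInput n ℓ) (P : RamProgram) (s : RamState) (B : ℕ) (Q : RamState → Prop) : Prop :=
  ∃ s' m, m ≤ B ∧ (∀ K, (ramStep E)^[m] (P :: K, s) = (K, s')) ∧ Q s'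

theorem Runs.mono {P : RamProgram} {s : RamState} {B B' : ℕ} {Q Q' : RamState → Prop}
    (h : Runs E P s B Q) (hB : B ≤ B') (hQ : ∀ s', Q s' → Q' s') : Runs E P s B' Q' := by
  obtain ⟨s', m, hm, hK, hQs⟩ := h
  exact ⟨s', m, hm.trans hB, hK, hQ _ hQs⟩

theorem runs_instr {i : RamInstr} {s : RamState} {Q : RamState → Prop} (h : Q (i.exec E s)) :
    Runs E (.instr i) s 1 Q :=
  ⟨_, 1, le_rfl, fun _ => rfl, h⟩

theorem Runs.seq {P R : RamProgram} {s : RamState} {B B' : ℕ} {Q Q' : RamState → Prop}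
    (h : Runs E P s B Q) (h' : ∀ s', Q s' → Runs E R s' B' Q') :
    Runs E (.seq P R) s (B + B' + 1) Q' := by
  obtain ⟨s', m, hm, hK, hQ⟩ := h
  obtain ⟨s'', m', hm', hK', hQ'⟩ := h' s' hQ
  refine ⟨s'', m' + m + 1, by omega, fun K => ?_, hQ'⟩
  rw [Function.iterate_succ_apply, Function.iterate_add_apply]
  exact (congrArg _ (hK (R :: K))).trans (hK' K)

theorem Runs.branch {t : RamTest} {P R : RamProgram} {s : RamState} {B : ℕ}
    {Q : RamState → Prop} (h : t.Holds s → Runs E P s B Q) (h' : ¬ t.Holds s → Runs E R s B Q) :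
    Runs E (.branch t P R) s (B + 1) Q := by
  by_cases ht : t.Holds s
  · obtain ⟨s', m, hm, hK, hQ⟩ := h ht
    refine ⟨s', m + 1, by omega, fun K => ?_, hQ⟩
    rw [Function.iterate_succ_apply, ← hK K]
    simp [ramStep, ht]
  · obtain ⟨s', m, hm, hK, hQ⟩ := h' ht
    refine ⟨s', m + 1, by omega, fun K => ?_, hQ⟩
    rw [Function.iterate_succ_apply, ← hK K]
    simp [ramStep, ht]

/-- A loop that runs `N` times with the invariant `I`. -/
theorem runs_loop {t : RamTest} {P : RamProgram} {B : ℕ} (N : ℕ) (I : ℕ → RamState → Prop)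
    (hI : ∀ j < N, ∀ s, I j s → t.Holds s ∧ Runs E P s B (I (j + 1)))
    (hN : ∀ s, I N s → ¬ t.Holds s) {s : RamState} (hs : I 0 s) :
    Runs E (.loop t P) s (N * (B + 1) + 1) (I N) := by
  have key : ∀ r j, j + r = N → ∀ s, I j s → Runs E (.loop t P) s (r * (B + 1) + 1) (I N) := by
    intro r
    induction r with
    | zero =>
      rintro j rfl s hs
      refine ⟨s, 1, by omega, fun K => ?_, hs⟩
      simp [ramStep, hN s hs]
    | succ r ih =>
      intro j hj s hs
      obtain ⟨ht, s', m, hm, hK, hQ⟩ := hI j (by omega) s hs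
      obtain ⟨s'', m', hm', hK', hQ'⟩ := ih (j + 1) (by omega) s' hQ
      refine ⟨s'', m' + m + 1, ?_, fun K => ?_, hQ'⟩
      · rw [Nat.succ_mul]
        omega
      · rw [Function.iterate_succ_apply, Function.iterate_add_apply, ← hK' K,
          ← hK (.loop t P :: K)]
        simp [ramStep, ht]
  exact key N 0 (zero_add N) s hs

/-- First the instructions `is`, then the program `P`. -/
def after (is : List RamInstr) (P : RamProgram) : RamProgram :=
  is.foldr (fun i R => .seq (.instr i) R) P

theorem runs_after {is : List RamInstr} {P : RamProgram} {s : RamState} {B : ℕ}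
    {Q : RamState → Prop} (h : Runs E P (is.foldl (fun s i => i.exec E s) s) B Q) :
    Runs E (after is P) s (2 * is.length + B) Q := by
  induction is generalizing s with
  | nil => simpa [after] using h
  | cons i is ih =>
    refine ((runs_instr (Q := fun s' => s' = i.exec E s) rfl).seq fun s' hs' => ?_).mono
      (B := 1 + (2 * is.length + B) + 1) ?_ fun _ => id
    · subst hs'
      exact ih h
    · rw [List.length_cons]
      omega

theorem Runs.configAfter {P : RamProgram} {s : RamState} {B : ℕ} {Q : RamState → Prop}
    (h : Runs E P s B Q) : P.runningTime E s ≤ B ∧ Q (P.finalState E s) := by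
  obtain ⟨s', m, hm, hK, hQ⟩ := h
  have hc : P.configAfter E s m = ([], s') := hK []
  have hmem : (m : ℕ∞) ∈ {m : ℕ∞ | ∃ r : ℕ, m = r ∧ (P.configAfter E s r).1 = []} :=
    ⟨m, rfl, by rw [hc]⟩
  have hle : P.runningTime E s ≤ m := sInf_le hmem
  obtain ⟨r, hr, hr'⟩ := csInf_mem (Set.nonempty_of_mem hmem)
  change P.runningTime E s = r at hr
  refine ⟨hle.trans (by exact_mod_cast hm), ?_⟩
  rw [hr, Nat.cast_le] at hle
  -- A halted configuration is a fixed point, so going on from the first halting time `r` to `m`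
  -- changes nothing.
  have hfix : ∀ d, (ramStep E)^[d] (P.configAfter E s r) = P.configAfter E s r := by
    intro d
    refine Function.iterate_fixed ?_ d
    generalize P.configAfter E s r = c at hr'
    obtain ⟨K, s₁⟩ := c
    obtain rfl : K = [] := hr'
    rfl
  have : P.configAfter E s m = P.configAfter E s r := by
    rw [← hfix (m - r), RamProgram.configAfter, RamProgram.configAfter,
      ← Function.iterate_add_apply, Nat.sub_add_cancel hle]
  rw [finalState, hr, ENat.toNat_natCast, ← this, hc]
  exact hQ

end RamProgram

/-! ### The mechanism -/

/-- The coordinate number `i` of `x`, and `0` outside the range. -/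
def coord {ℓ : ℕ} (x : L1Space ℓ) (i : ℕ) : ℝ := if h : i < ℓ then x ⟨i, h⟩ else 0

/-- The coordinate number `i` of the database point number `j`, and `0` outside the range. -/
def entry {n ℓ : ℕ} (D : Fin n → L1Space ℓ) (j i : ℕ) : ℝ :=
  if h : j < n then coord (D ⟨j, h⟩) i else 0

/-- The binary expansion of `y ∈ [0,1]`, as a path that descends from the root `1` of a binary tree
in which `v` has the children `2v` and `2v + 1`: the node reached after `m` steps, and what remains
of `y`. -/
noncomputable def descent (y : ℝ) : ℕ → ℕ × ℝ
  | 0 => (1, y)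
  | m + 1 =>
    if (descent y m).2 < 2 / 2 ^ (m + 1) then (2 * (descent y m).1, (descent y m).2)
    else (2 * (descent y m).1 + 1, (descent y m).2 - 2 / 2 ^ (m + 1))

/-- What the mechanism computes from the public parameters: the scales of the noise added to the
data, to the nodes of the trees and to the answer, whether queries are rounded (`1`) or not (`0`),
and the depth of the trees. -/
structure Tuning where
  dataScale : ℝ
  nodeScale : ℝ
  answerScale : ℝ
  rounding : ℝ
  depth : ℕ

/-- The number of binary digits needed for the precision `t`. -/
noncomputable def digits (t : ℝ) : ℕ := sInf {J : ℕ | 1 / 2 ^ J ≤ t}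

namespace ReleaseParams

/-- The ratio `log (k / β) / (n ε)`, which governs the error. -/
noncomputable def ratio (p : ReleaseParams) : ℝ := Real.log (p.k / p.β) / (p.n * p.ε)

open Classical in
/-- A single query is answered with noise. Several queries are answered from a noisy copy of the
data if the privacy parameter is exponentially large, and from noisy trees otherwise. -/
noncomputable def tuning (p : ReleaseParams) : Tuning :=
  if 1 < p.k then
    if p.ratio < Real.exp (-p.n) then ⟨1 / p.ε, 0, 0, 0, 0⟩
    -- One level more than `digits`, because the first step of `descent` compares with `1` and
    -- splits off the integer part of `y`.
    else ⟨0, ((digits p.ratio + 1 : ℕ) : ℝ) * 2 / (p.n * p.ε), 0, 1, digits p.ratio + 1⟩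
  else ⟨0, 0, 1 / (p.n * p.ε), 0, 0⟩

end ReleaseParams

namespace Tuning

/-- The total noise on the path to the query `y` in the tree of coordinate number `i`. -/
noncomputable def pathNoise (τ : Tuning) (ℓ : ℕ) (ξ : ℕ → ℝ) (i : ℕ) (y : ℝ) : ℝ :=
  ∑ m ∈ Finset.range τ.depth, ξ ((descent y (m + 1)).1 * ℓ + i)

/-- The place at which the distances to a query with the coordinate `y` are measured. -/
noncomputable def place (τ : Tuning) (y : ℝ) : ℝ := y - (descent y τ.depth).2 * τ.rounding

/-- The contribution of the database point number `j` and the coordinate number `i`. -/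
noncomputable def term (τ : Tuning) {n ℓ : ℕ} (D : Fin n → L1Space ℓ) (ξ : ℕ → ℝ) (i j : ℕ)
    (y : ℝ) : ℝ :=
  |entry D j i + ξ (j * ℓ + i) * τ.dataScale - τ.place y| / n

/-- The noisy answer to the query `y`, for the noise `ξ`. -/
noncomputable def rawAnswer (τ : Tuning) {n ℓ : ℕ} (D : Fin n → L1Space ℓ) (ξ : ℕ → ℝ)
    (y : L1Space ℓ) : ℝ :=
  -- The three kinds of noise share the cells of `ξ`; this is harmless because `tuning` makes at
  -- most one scale nonzero.
  ∑ i ∈ Finset.range ℓ, (τ.pathNoise ℓ ξ i (coord y i) * τ.nodeScale +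
    ∑ j ∈ Finset.range n, τ.term D ξ i j (coord y i)) + ξ 0 * τ.answerScale

/-- The answer to the query `y`, for the noise `ξ`. -/
noncomputable def respond (τ : Tuning) {n ℓ : ℕ} (D : Fin n → L1Space ℓ) (ξ : ℕ → ℝ)
    (y : L1Space ℓ) : ℝ :=
  max 0 (min 1 (τ.rawAnswer D ξ y))

end Tuning

/-! ### The program -/

namespace RamProgram

open RamInstr RamTest

/-- Put the noise of the cell with the number `N[7]` into `R[20]`. -/
def sampleCode : List RamInstr := [loadRandom 20 7, realSub 21 10 20, realDiv 20 20 21, realLog 20 20]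

/-- Compute the tuning. -/
def setupCode : RamProgram :=
  after [natConst 3 1, natConst 8 0, realOfNat 4 0, realConst 5 0, realConst 6 0, realConst 7 0,
    realConst 8 0, realConst 10 1, realConst 16 0, realConst 17 2, realMul 9 4 0]
  (.branch (natLt 3 2)
    (after [realOfNat 11 2, realDiv 11 11 2, realLog 11 11, realDiv 11 11 9, realSub 12 16 4,
      realExp 12 12]
      (.branch (realLt 11 12) (.instr (realDiv 5 10 0))
        (.seq
          (after [realConst 8 1, natConst 8 1, realConst 12 1]
            (.loop (realLt 11 12) (after [natAdd 8 8 3] (.instr (realDiv 12 12 17)))))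
          (after [realOfNat 6 8, realMul 6 6 17] (.instr (realDiv 6 6 9))))))
    (.instr (realDiv 7 10 9)))

/-- Descend by one level in the tree of coordinate number `N[4]`. -/
def descendCode : RamProgram :=
  .seq
    (after [realDiv 14 14 17, natAdd 6 6 6]
      -- `N[3]` is `1` already, so `natConst 3 1` does nothing. `N[6]` holds the node number times
      -- `ℓ`, so a right child adds `N[1] = ℓ` and no multiplication of naturals is needed.
      (.branch (realLt 13 14) (.instr (natConst 3 1))
        (after [realSub 13 13 14] (.instr (natAdd 6 6 1)))))
    (after (natAdd 7 6 4 :: sampleCode ++ [realAdd 15 15 20]) (.instr (natAdd 5 5 3)))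

/-- Add the contribution of the database point number `N[5]` and coordinate number `N[4]`. -/
def dataCode : RamProgram :=
  .seq
    (after (sampleCode ++ [loadData 11 5 4, realMul 20 20 5, realAdd 11 11 20, realSub 11 11 13])
      (.branch (realLt 11 16) (.instr (realSub 11 16 11)) (.instr (natConst 3 1))))
    (after [realDiv 11 11 4, realAdd 3 3 11, natAdd 7 7 1] (.instr (natAdd 5 5 3)))

/-- Add the contribution of the coordinate number `N[4]`. -/
def coordCode : RamProgram :=
  .seq
    (after [loadQuery 13 4, realConst 14 2, realConst 15 0, natConst 5 0, natConst 6 0, natAdd 6 6 1]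
      (.loop (natLt 5 8) descendCode))
    (.seq
      (after [realMul 15 15 6, realAdd 3 3 15, realMul 13 13 8, loadQuery 15 4, realSub 13 15 13,
        natConst 5 0, natConst 7 0, natAdd 7 7 4]
        (.loop (natLt 5 0) dataCode))
      (.instr (natAdd 4 4 3)))

/-- Add the noise of the answer, and clip. -/
def clipCode : RamProgram :=
  after (natConst 7 0 :: sampleCode ++ [realMul 20 20 7, realAdd 3 3 20])
    (.branch (realLt 3 16) (.instr (realConst 3 0))
      (.branch (realLt 10 3) (.instr (realConst 3 1)) (.instr (natConst 3 1))))

/-- The program that answers distance queries. -/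
def distanceQueryCode : RamProgram :=
  .seq setupCode
    (.seq (after [realConst 3 0, natConst 4 0] (.loop (natLt 4 1) coordCode)) clipCode)

/-! ### Correctness of the program -/

/-- The memories contain the public parameters. -/
structure Holding (p : ReleaseParams) (s : RamState) : Prop where
  n : s.nat 0 = p.n
  ℓ : s.nat 1 = p.ℓ
  k : s.nat 2 = p.k
  ε : s.real 0 = p.ε
  β : s.real 2 = p.β

/-- The memories contain the public parameters, the tuning, and some constants. -/
structure Tuned (p : ReleaseParams) (τ : Tuning) (s : RamState) : Prop extends Holding p s where
  one : s.nat 3 = 1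
  depth : s.nat 8 = τ.depth
  size : s.real 4 = p.n
  dataScale : s.real 5 = τ.dataScale
  nodeScale : s.real 6 = τ.nodeScale
  answerScale : s.real 7 = τ.answerScale
  rounding : s.real 8 = τ.rounding
  realOne : s.real 10 = 1
  realZero : s.real 16 = 0
  realTwo : s.real 17 = 2

variable {p : ReleaseParams} {τ : Tuning} {E : RamInput p.n p.ℓ}

/-- The invariant of the descent. -/
structure Descending (p : ReleaseParams) (τ : Tuning) (E : RamInput p.n p.ℓ) (i : ℕ) (y a : ℝ)
    (m : ℕ) (s : RamState) : Prop extends Tuned p τ s where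
  index : s.nat 4 = i
  level : s.nat 5 = m
  node : s.nat 6 = (descent y m).1 * p.ℓ
  acc : s.real 3 = a
  rest : s.real 13 = (descent y m).2
  step : s.real 14 = 2 / 2 ^ m
  sum : s.real 15 = ∑ m ∈ Finset.range m, noise E.tape ((descent y (m + 1)).1 * p.ℓ + i)

theorem runs_descendCode {i m : ℕ} {y a : ℝ} {s : RamState} (h : Descending p τ E i y a m s) :
    Runs E descendCode s 25 (Descending p τ E i y a (m + 1)) := by
  obtain ⟨⟨⟨h0, h1, h2, h3, h4⟩, h5, h6, h7, h8, h9, h10, h11, h12, h13, h14⟩, h15, h16, h17, h18,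
    h19, h20, h21⟩ := h
  refine Runs.mono (Runs.seq (Q := fun s' => Tuned p τ s' ∧ s'.nat 4 = i ∧ s'.nat 5 = m ∧
    s'.nat 6 = (descent y (m + 1)).1 * p.ℓ ∧ s'.real 3 = a ∧ s'.real 13 = (descent y (m + 1)).2 ∧
    s'.real 14 = 2 / 2 ^ (m + 1) ∧ s'.real 15 = s.real 15) (runs_after
      (Runs.branch (B := 3) (fun ht => (runs_instr ?_).mono (by norm_num) fun _ => id)
      (fun ht => runs_after (runs_instr ?_))))
    fun s' hs' => runs_after (runs_instr ?_)) (by simp [sampleCode]) fun _ => id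
  · have ht' : (descent y m).2 < 2 / 2 ^ (m + 1) := by
      simpa [RamTest.Holds, RamInstr.exec, RamState.setNat, RamState.setReal, Function.update_apply, *,
        pow_succ, div_div] using ht
    refine ⟨⟨⟨?_, ?_, ?_, ?_, ?_⟩, ?_, ?_, ?_, ?_, ?_, ?_, ?_, ?_, ?_, ?_⟩,
      ?_, ?_, ?_, ?_, ?_, ?_, ?_⟩ <;>
    simp [RamInstr.exec, RamState.setNat, RamState.setReal, *, descent]
    · ring
    · rw [pow_succ, div_div]
  · have ht' : ¬ (descent y m).2 < 2 / 2 ^ (m + 1) := by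
      simpa [RamTest.Holds, RamInstr.exec, RamState.setNat, RamState.setReal, Function.update_apply, *,
        pow_succ, div_div] using ht
    refine ⟨⟨⟨?_, ?_, ?_, ?_, ?_⟩, ?_, ?_, ?_, ?_, ?_, ?_, ?_, ?_, ?_, ?_⟩,
      ?_, ?_, ?_, ?_, ?_, ?_, ?_⟩ <;>
    simp [RamInstr.exec, RamState.setNat, RamState.setReal, *, descent]
    · ring
    · rw [pow_succ, div_div]
    · rw [pow_succ, div_div]
  · obtain ⟨⟨⟨g0, g1, g2, g3, g4⟩, g5, g6, g7, g8, g9, g10, g11, g12, g13, g14⟩, g15, g16, g17, g18,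
      g19, g20, g21⟩ := hs'
    refine ⟨⟨⟨?_, ?_, ?_, ?_, ?_⟩, ?_, ?_, ?_, ?_, ?_, ?_, ?_, ?_, ?_, ?_⟩, ?_, ?_, ?_, ?_, ?_, ?_,
      ?_⟩ <;>
    simp [RamInstr.exec, RamState.setNat, RamState.setReal, *, sampleCode,
      Finset.sum_range_succ, noise, logit]

end RamProgram

/-! ### Binary digits and the depth of the trees. -/

theorem digits_nonempty {t : ℝ} (ht : 0 < t) : {J : ℕ | 1 / 2 ^ J ≤ t}.Nonempty := by
  obtain ⟨J, hJ⟩ := exists_pow_lt_of_lt_one ht (one_half_lt_one (α := ℝ))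
  rw [one_div_pow] at hJ
  exact ⟨J, hJ.le⟩

theorem digits_spec {t : ℝ} (ht : 0 < t) : 1 / 2 ^ digits t ≤ t := Nat.sInf_mem (digits_nonempty ht)

theorem lt_of_lt_digits {t : ℝ} {J : ℕ} (h : J < digits t) : t < 1 / 2 ^ J :=
  not_le.1 (Nat.notMem_of_lt_sInf h)

/-- Trees are used only if `ratio ≥ e^(-n) > 4^(-n)`, so `2 n` digits suffice. -/
theorem depth_tuning_le (p : ReleaseParams) (hn : 1 ≤ p.n) : p.tuning.depth ≤ 3 * p.n := by
  unfold ReleaseParams.tuning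
  split_ifs with hk ht
  · simp
  · rw [not_lt] at ht
    by_contra! h
    have h1 : 2 * p.n < digits p.ratio := by simp only at h; omega
    have h2 := ht.trans_lt (lt_of_lt_digits h1)
    rw [Real.exp_neg, one_div, inv_lt_inv₀ (Real.exp_pos _) (by positivity), pow_mul] at h2
    have h3 : Real.exp (p.n : ℝ) = Real.exp 1 ^ p.n := by rw [← Real.exp_nat_mul, mul_one]
    rw [h3] at h2
    exact absurd h2 (not_lt.2 (pow_le_pow_left₀ (Real.exp_pos _).le
      (by linarith [Real.exp_one_lt_d9]) _))
  · simp

/-! ### Correctness of the loops and the running time. -/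

namespace RamProgram

open RamInstr RamTest

variable {p : ReleaseParams} {τ : Tuning} {E : RamInput p.n p.ℓ}

/-- The invariant of the loop over the database. -/
structure Summing (p : ReleaseParams) (τ : Tuning) (E : RamInput p.n p.ℓ) (i : ℕ) (y a : ℝ)
    (m : ℕ) (s : RamState) : Prop extends Tuned p τ s where
  index : s.nat 4 = i
  point : s.nat 5 = m
  cell : s.nat 7 = m * p.ℓ + i
  place : s.real 13 = τ.place y
  acc : s.real 3 = a + ∑ j ∈ Finset.range m, τ.term E.data (noise E.tape) i j y

theorem entry_eq (D : Fin p.n → L1Space p.ℓ) (j i : ℕ) :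
    (if h : j < p.n ∧ i < p.ℓ then D ⟨j, h.1⟩ ⟨i, h.2⟩ else 0) = entry D j i := by
  unfold entry coord
  by_cases hj : j < p.n <;> by_cases hi : i < p.ℓ <;> simp [hj, hi]

theorem runs_dataCode {i m : ℕ} {y a : ℝ} {s : RamState} (h : Summing p τ E i y a m s) :
    Runs E dataCode s 26 (Summing p τ E i y a (m + 1)) := by
  obtain ⟨⟨⟨h0, h1, h2, h3, h4⟩, h5, h6, h7, h8, h9, h10, h11, h12, h13, h14⟩, h15, h16, h17, h18,
    h19⟩ := h
  set v := entry E.data m i + noise E.tape (m * p.ℓ + i) * τ.dataScale - τ.place y with hv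
  refine Runs.mono (Runs.seq (Q := fun s' => Tuned p τ s' ∧ s'.nat 4 = i ∧ s'.nat 5 = m ∧
    s'.nat 7 = m * p.ℓ + i ∧ s'.real 13 = τ.place y ∧ s'.real 3 = s.real 3 ∧ s'.real 11 = |v|)
    (runs_after (Runs.branch (B := 1) (fun ht => runs_instr ?_) (fun ht => runs_instr ?_)))
    fun s' hs' => runs_after (runs_instr ?_)) (by simp [sampleCode]) fun _ => id
  · have ht' : v < 0 := by
      simpa [RamTest.Holds, RamInstr.exec, RamState.setNat, RamState.setReal, *, entry_eq,
        sampleCode, noise, logit] using ht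
    rw [abs_of_neg ht']
    refine ⟨⟨⟨?_, ?_, ?_, ?_, ?_⟩, ?_, ?_, ?_, ?_, ?_, ?_, ?_, ?_, ?_, ?_⟩,
      ?_, ?_, ?_, ?_, ?_, ?_⟩ <;>
    simp [RamInstr.exec, RamState.setNat, RamState.setReal, *, entry_eq, sampleCode, noise, logit]
  · have ht' : ¬ v < 0 := by
      simpa [RamTest.Holds, RamInstr.exec, RamState.setNat, RamState.setReal, *, entry_eq,
        sampleCode, noise, logit] using ht
    rw [abs_of_nonneg (not_lt.1 ht')]
    refine ⟨⟨⟨?_, ?_, ?_, ?_, ?_⟩, ?_, ?_, ?_, ?_, ?_, ?_, ?_, ?_, ?_, ?_⟩,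
      ?_, ?_, ?_, ?_, ?_, ?_⟩ <;>
    simp [RamInstr.exec, RamState.setNat, RamState.setReal, *, entry_eq, sampleCode, noise, logit]
  · obtain ⟨⟨⟨g0, g1, g2, g3, g4⟩, g5, g6, g7, g8, g9, g10, g11, g12, g13, g14⟩, g15, g16, g17, g18,
      g19, g20⟩ := hs'
    refine ⟨⟨⟨?_, ?_, ?_, ?_, ?_⟩, ?_, ?_, ?_, ?_, ?_, ?_, ?_, ?_, ?_, ?_⟩, ?_, ?_, ?_, ?_, ?_⟩ <;>
    simp [RamInstr.exec, RamState.setNat, RamState.setReal, *]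
    · ring
    · rw [Finset.sum_range_succ, Tuning.term, add_assoc]

/-- The invariant of the loop over the coordinates. -/
structure Accumulating (p : ReleaseParams) (τ : Tuning) (E : RamInput p.n p.ℓ) (i : ℕ)
    (s : RamState) : Prop extends Tuned p τ s where
  index : s.nat 4 = i
  acc : s.real 3 = ∑ i ∈ Finset.range i,
    (τ.pathNoise p.ℓ (noise E.tape) i (coord E.query i) * τ.nodeScale +
      ∑ j ∈ Finset.range p.n, τ.term E.data (noise E.tape) i j (coord E.query i))

theorem runs_coordCode {i : ℕ} {s : RamState} (h : Accumulating p τ E i s) :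
    Runs E coordCode s (τ.depth * 26 + p.n * 27 + 33) (Accumulating p τ E (i + 1)) := by
  obtain ⟨⟨⟨h0, h1, h2, h3, h4⟩, h5, h6, h7, h8, h9, h10, h11, h12, h13, h14⟩, h15, h16⟩ := h
  set y := coord E.query i with hy
  have hq : (if h : i < p.ℓ then E.query ⟨i, h⟩ else 0) = y := rfl
  refine Runs.mono (Runs.seq (Q := Descending p τ E i y (s.real 3) τ.depth)
    (runs_after (runs_loop τ.depth (Descending p τ E i y (s.real 3)) (B := 25)
      (fun j hj s hs => ⟨?_, runs_descendCode hs⟩) (fun s hs => ?_) ?_)) fun s' hs' =>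
    Runs.seq (Q := Summing p τ E i y
      (s.real 3 + τ.pathNoise p.ℓ (noise E.tape) i y * τ.nodeScale) p.n)
    (runs_after (runs_loop p.n (Summing p τ E i y _) (B := 26)
      (fun j hj s hs => ⟨?_, runs_dataCode hs⟩) (fun s hs => ?_) ?_)) fun s' hs' =>
    runs_instr ?_) (by simp only [List.length_cons, List.length_nil]; omega) fun _ => id
  · simpa [RamTest.Holds, hs.level, hs.depth] using hj
  · simp [RamTest.Holds, hs.level, hs.depth]
  · refine ⟨⟨⟨?_, ?_, ?_, ?_, ?_⟩, ?_, ?_, ?_, ?_, ?_, ?_, ?_, ?_, ?_, ?_⟩, ?_, ?_, ?_, ?_, ?_, ?_,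
      ?_⟩ <;>
    simp [RamInstr.exec, RamState.setNat, RamState.setReal, *, descent]
  · simpa [RamTest.Holds, hs.point, hs.n] using hj
  · simp [RamTest.Holds, hs.point, hs.n]
  · obtain ⟨⟨⟨g0, g1, g2, g3, g4⟩, g5, g6, g7, g8, g9, g10, g11, g12, g13, g14⟩, g15, g16, g17, g18,
      g19, g20, g21⟩ := hs'
    refine ⟨⟨⟨?_, ?_, ?_, ?_, ?_⟩, ?_, ?_, ?_, ?_, ?_, ?_, ?_, ?_, ?_, ?_⟩, ?_, ?_, ?_, ?_, ?_⟩ <;>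
    simp [RamInstr.exec, RamState.setNat, RamState.setReal, *, Tuning.place, Tuning.pathNoise]
  · obtain ⟨⟨⟨g0, g1, g2, g3, g4⟩, g5, g6, g7, g8, g9, g10, g11, g12, g13, g14⟩, g15, g16, g17, g18,
      g19⟩ := hs'
    refine ⟨⟨⟨?_, ?_, ?_, ?_, ?_⟩, ?_, ?_, ?_, ?_, ?_, ?_, ?_, ?_, ?_, ?_⟩, ?_, ?_⟩ <;>
    simp [RamInstr.exec, RamState.setNat, *, Finset.sum_range_succ, add_assoc]

theorem runs_clipCode {s : RamState} (h : Accumulating p τ E p.ℓ s) :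
    Runs E clipCode s 20 fun s' =>
      Holding p s' ∧ s'.real 3 = τ.respond E.data (noise E.tape) E.query := by
  obtain ⟨⟨⟨h0, h1, h2, h3, h4⟩, h5, h6, h7, h8, h9, h10, h11, h12, h13, h14⟩, h15, h16⟩ := h
  set v := τ.rawAnswer E.data (noise E.tape) E.query with hv
  have hv' := hv
  rw [Tuning.rawAnswer, ← h16] at hv'
  refine Runs.mono (runs_after (Runs.branch (B := 2)
    (fun ht => Runs.mono (B := 1) (runs_instr ?_) (by norm_num) fun _ => id)
    (fun ht => Runs.branch (B := 1) (fun ht₁ => runs_instr ?_) (fun ht₁ => runs_instr ?_))))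
    (by simp [sampleCode]) fun _ => id
  · have ht' : v < 0 := by
      simpa [RamTest.Holds, RamInstr.exec, RamState.setNat, RamState.setReal, sampleCode, h13, h12,
        hv', noise, logit, h10] using ht
    refine ⟨⟨?_, ?_, ?_, ?_, ?_⟩, ?_⟩
    on_goal 6 => rw [Tuning.respond, ← hv, max_eq_left ((min_le_right _ _).trans ht'.le)]
    all_goals simp [RamInstr.exec, RamState.setNat, RamState.setReal, *, sampleCode]
  · have ht' : 1 < v := by
      simpa [RamTest.Holds, RamInstr.exec, RamState.setNat, RamState.setReal, sampleCode, h13, h12,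
        hv', noise, logit, h10] using ht₁
    refine ⟨⟨?_, ?_, ?_, ?_, ?_⟩, ?_⟩
    on_goal 6 => rw [Tuning.respond, ← hv, min_eq_left ht'.le, max_eq_right zero_le_one]
    all_goals simp [RamInstr.exec, RamState.setNat, RamState.setReal, *, sampleCode]
  · have ht' : ¬ v < 0 := by
      simpa [RamTest.Holds, RamInstr.exec, RamState.setNat, RamState.setReal, sampleCode, h13, h12,
        hv', noise, logit, h10] using ht
    have ht'' : ¬ 1 < v := by
      simpa [RamTest.Holds, RamInstr.exec, RamState.setNat, RamState.setReal, sampleCode, h13, h12,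
        hv', noise, logit, h10] using ht₁
    refine ⟨⟨?_, ?_, ?_, ?_, ?_⟩, ?_⟩
    on_goal 6 => rw [Tuning.respond, ← hv, min_eq_right (not_lt.1 ht''), max_eq_right (not_lt.1 ht'),
      hv']
    all_goals simp [RamInstr.exec, RamState.setNat, RamState.setReal, sampleCode, noise, logit, h0,
      h1, h2, h3, h4, h10, h12]

theorem runs_setupCode (hn : 1 ≤ p.n) {s : RamState} (h : Holding p s) :
    Runs E setupCode s (p.n * 12 + 60) (Tuned p p.tuning) := by
  obtain ⟨h0, h1, h2, h3, h4⟩ := h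
  have hd := depth_tuning_le p hn
  refine Runs.mono (B := 2 * 11 + ((12 + ((p.n * 12 + 18) + 1)) + 1)) (runs_after (Runs.branch
    (fun ht => runs_after (Runs.branch (fun ht₁ => Runs.mono (B := 1) (runs_instr ?_) (by omega)
      fun _ => id) fun ht₁ => ?_))
    (fun ht => Runs.mono (B := 1) (runs_instr ?_) (by omega) fun _ => id))) (by omega) fun _ => id
  · have ht' : 1 < p.k := by
      simpa [RamTest.Holds, RamInstr.exec, RamState.setNat, RamState.setReal, *] using ht
    have ht₁' : p.ratio < Real.exp (-p.n) := by
      simpa [RamTest.Holds, RamInstr.exec, RamState.setNat, RamState.setReal, *,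
        ReleaseParams.ratio] using ht₁
    rw [ReleaseParams.tuning, if_pos ht', if_pos ht₁']
    refine ⟨⟨?_, ?_, ?_, ?_, ?_⟩, ?_, ?_, ?_, ?_, ?_, ?_, ?_, ?_, ?_, ?_⟩ <;>
    simp [RamInstr.exec, RamState.setNat, RamState.setReal, *]
  · have ht' : 1 < p.k := by
      simpa [RamTest.Holds, RamInstr.exec, RamState.setNat, RamState.setReal, *] using ht
    have ht₁' : ¬ p.ratio < Real.exp (-p.n) := by
      simpa [RamTest.Holds, RamInstr.exec, RamState.setNat, RamState.setReal, *,
        ReleaseParams.ratio] using ht₁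
    rw [ReleaseParams.tuning, if_pos ht', if_neg ht₁'] at hd ⊢
    have hpos : 0 < p.ratio := (Real.exp_pos _).trans_le (not_lt.1 ht₁')
    set I : ℕ → RamState → Prop := fun j s' =>
      Tuned p ⟨0, 0, 0, 1, j + 1⟩ s' ∧ s'.real 11 = p.ratio ∧ s'.real 12 = 1 / 2 ^ j ∧
        s'.real 9 = p.n * p.ε with hI
    refine Runs.mono (Runs.seq (Q := I (digits p.ratio)) (runs_after (runs_loop (digits p.ratio) I
      (B := 3) (fun j hj s hs => ⟨?_, runs_after (runs_instr ?_)⟩) (fun s hs => ?_) ?_))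
      fun s' hs' => runs_after (runs_instr ?_)) (by simp at hd ⊢; omega) fun _ => id
    · change s.real 11 < s.real 12
      rw [hs.2.1, hs.2.2.1]
      exact lt_of_lt_digits hj
    · obtain ⟨⟨⟨g0, g1, g2, g3, g4⟩, g5, g6, g7, g8, g9, g10, g11, g12, g13, g14⟩, g15, g16, g17⟩ :=
        hs
      refine ⟨⟨⟨?_, ?_, ?_, ?_, ?_⟩, ?_, ?_, ?_, ?_, ?_, ?_, ?_, ?_, ?_, ?_⟩, ?_, ?_, ?_⟩ <;>
      simp [RamInstr.exec, RamState.setNat, RamState.setReal, *]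
      rw [pow_succ]
      field_simp
    · change ¬ s.real 11 < s.real 12
      rw [hs.2.1, hs.2.2.1]
      exact not_lt.2 (digits_spec hpos)
    · refine ⟨⟨⟨?_, ?_, ?_, ?_, ?_⟩, ?_, ?_, ?_, ?_, ?_, ?_, ?_, ?_, ?_, ?_⟩, ?_, ?_, ?_⟩ <;>
      simp [RamInstr.exec, RamState.setNat, RamState.setReal, *, ReleaseParams.ratio]
    · obtain ⟨⟨⟨g0, g1, g2, g3, g4⟩, g5, g6, g7, g8, g9, g10, g11, g12, g13, g14⟩, g15, g16, g17⟩ :=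
        hs'
      refine ⟨⟨?_, ?_, ?_, ?_, ?_⟩, ?_, ?_, ?_, ?_, ?_, ?_, ?_, ?_, ?_, ?_⟩ <;>
      simp [RamInstr.exec, RamState.setNat, RamState.setReal, *]
  · have ht' : ¬ 1 < p.k := by
      simpa [RamTest.Holds, RamInstr.exec, RamState.setNat, RamState.setReal, *] using ht
    rw [ReleaseParams.tuning, if_neg ht']
    refine ⟨⟨?_, ?_, ?_, ?_, ?_⟩, ?_, ?_, ?_, ?_, ?_, ?_, ?_, ?_, ?_, ?_⟩ <;>
    simp [RamInstr.exec, RamState.setNat, RamState.setReal, *]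

/-- Only the public parameters must survive from query to query: everything else is recomputed, and
the random array returns the same noise for the same node. -/
theorem runs_distanceQueryCode (hn : 1 ≤ p.n) (hℓ : 1 ≤ p.ℓ) {s : RamState} (h : Holding p s) :
    Runs E distanceQueryCode s (250 * (p.ℓ * p.n)) fun s' =>
      Holding p s' ∧ s'.real 3 = p.tuning.respond E.data (noise E.tape) E.query := by
  refine Runs.mono (Runs.seq (runs_setupCode hn h) fun s' hs' => Runs.seq
    (runs_after (runs_loop p.ℓ (Accumulating p p.tuning E) (fun j hj s hs => ⟨?_, runs_coordCode hs⟩)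
      (fun s hs => ?_) ?_)) fun s'' hs'' => runs_clipCode hs'') ?_ fun _ => id
  · simpa [RamTest.Holds, hs.index, hs.ℓ] using hj
  · simp [RamTest.Holds, hs.index, hs.ℓ]
  · obtain ⟨⟨g0, g1, g2, g3, g4⟩, g5, g6, g7, g8, g9, g10, g11, g12, g13, g14⟩ := hs'
    refine ⟨⟨⟨?_, ?_, ?_, ?_, ?_⟩, ?_, ?_, ?_, ?_, ?_, ?_, ?_, ?_, ?_, ?_⟩, ?_, ?_⟩ <;>
    simp [RamInstr.exec, RamState.setNat, RamState.setReal, *]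
  · have hd := depth_tuning_le p hn
    have h1 : p.n ≤ p.ℓ * p.n := Nat.le_mul_of_pos_left _ hℓ
    -- The depth is at most `3 n`, and `139 = 3 * 26 + 27 + 34`.
    have h2 : p.ℓ * (p.tuning.depth * 26 + p.n * 27 + 33 + 1) ≤ p.ℓ * (p.n * 139) := by
      gcongr
      omega
    have h3 : p.ℓ * (p.n * 139) = 139 * (p.ℓ * p.n) := by ring
    simp only [List.length_cons, List.length_nil]
    omega

end RamProgram

/-! ### Reduction to a function of the database, the noise and the query -/

/-- The answers that `A` receives if each query `y` is answered by `f y`. -/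
def replies {Y : Type} [MeasurableSpace Y] {X : Set Y} (A : Analyst X) (f : Y → ℝ) :
    (j : ℕ) → Fin j → ℝ
  | 0 => Fin.elim0
  | j + 1 => Fin.snoc (replies A f j) (f (A.ask j (replies A f j)))

theorem replies_congr {Y : Type} [MeasurableSpace Y] {X : Set Y} (A : Analyst X) {f g : Y → ℝ}
    {k : ℕ} (h : ∀ j < k, ∀ a, f (A.ask j a) = g (A.ask j a)) :
    ∀ j ≤ k, replies A f j = replies A g j
  | 0, _ => rfl
  | j + 1, hj => by
    have ih := replies_congr A h j (Nat.le_of_succ_le hj)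
    rw [replies, replies, ih, h j hj]

namespace RamProgram

variable {p : ReleaseParams} {X : Set (L1Space p.ℓ)}

theorem Holding.initialState (p : ReleaseParams) : Holding p p.initialState := by
  constructor <;> simp [ReleaseParams.initialState]

theorem holding_play (hn : 1 ≤ p.n) (hℓ : 1 ≤ p.ℓ) (D : Fin p.n → L1Space p.ℓ) (A : Analyst X)
    (ω : RandomTape) (j : ℕ) :
    Holding p ((distanceQueryCode.mechanism p).play D A ω j).1 := by
  induction j with
  | zero => exact Holding.initialState p
  | succ j ih => exact (runs_distanceQueryCode hn hℓ ih).configAfter.2.1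

theorem answerAt_eq (hn : 1 ≤ p.n) (hℓ : 1 ≤ p.ℓ) (D : Fin p.n → L1Space p.ℓ) (A : Analyst X)
    (ω : RandomTape) (j : ℕ) :
    (distanceQueryCode.mechanism p).answerAt D A ω j =
      p.tuning.respond D (noise ω) ((distanceQueryCode.mechanism p).queryAt D A ω j) :=
  (runs_distanceQueryCode (E := ⟨D, _, ω⟩) hn hℓ (holding_play hn hℓ D A ω j)).configAfter.2.2

/-- For a fixed random array the interaction is a game against one fixed function of the query. -/
theorem play_eq_replies (hn : 1 ≤ p.n) (hℓ : 1 ≤ p.ℓ) (D : Fin p.n → L1Space p.ℓ) (A : Analyst X)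
    (ω : RandomTape) (j : ℕ) :
    ((distanceQueryCode.mechanism p).play D A ω j).2 =
      replies A (p.tuning.respond D (noise ω)) j := by
  induction j with
  | zero => rfl
  | succ j ih =>
    rw [replies, ← ih]
    exact congrArg (Fin.snoc (α := fun _ => ℝ) _) (answerAt_eq hn hℓ D A ω j)

theorem answersInTime (hn : 1 ≤ p.n) (hℓ : 1 ≤ p.ℓ) :
    distanceQueryCode.AnswersInTime p X (250 * (p.ℓ * p.n)) := fun D _ A ω j _ =>
  (runs_distanceQueryCode hn hℓ (holding_play hn hℓ D A ω j)).configAfter.1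

/-- If one shift of the noise matches all answers, then adaptive transcripts agree by induction, and
the only cost is the change of law. The shift may depend on the analyst, which the case `k = 1`
exploits. -/
theorem isDifferentiallyPrivate_of_shift (hn : 1 ≤ p.n) (hℓ : 1 ≤ p.ℓ) (ε δ : ℝ)
    (h : ∀ D D' : Fin p.n → L1Space p.ℓ, (∀ i, D i ∈ X) → (∀ i, D' i ∈ X) → Adjacent D D' →
      ∀ A : Analyst X, ∃ c : ℕ → ℝ, (∀ s : Finset ℕ, ∑ a ∈ s, |c a| ≤ ε) ∧
        ∀ j < p.k, ∀ b ξ, p.tuning.respond D ξ (A.ask j b) =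
          p.tuning.respond D' (fun a => ξ a + c a) (A.ask j b)) :
    (distanceQueryCode.mechanism p).IsDifferentiallyPrivate tapeLaw X p.k ε δ := by
  intro D D' hD hD' hadj A S _
  obtain ⟨c, hc, hresp⟩ := h D D' hD hD' hadj A
  refine le_add_right (tapeLaw_le_of_shift c hc _ _ fun ω ω' hω hS => ?_)
  have hr : ∀ j ≤ p.k, replies A (p.tuning.respond D (noise ω)) j =
      replies A (p.tuning.respond D' (noise ω')) j := by
    refine replies_congr A fun j hj b => ?_
    rw [hresp j hj b, ← funext hω]
  have : (distanceQueryCode.mechanism p).transcript p.k D A ω =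
      (distanceQueryCode.mechanism p).transcript p.k D' A ω' := by
    funext j
    have hq : (distanceQueryCode.mechanism p).queryAt D A ω j =
        (distanceQueryCode.mechanism p).queryAt D' A ω' j := by
      rw [InteractiveMechanism.queryAt, InteractiveMechanism.queryAt, play_eq_replies hn hℓ,
        play_eq_replies hn hℓ, hr j j.2.le]
    rw [InteractiveMechanism.transcript, InteractiveMechanism.transcript, answerAt_eq hn hℓ,
      answerAt_eq hn hℓ, ← hq]
    congr 1
    rw [InteractiveMechanism.queryAt, hresp j j.2, ← funext hω]
  change _ ∈ S
  rw [← this]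
  exact hS

/-- A single event, that the first `M` noises are small, serves all queries at once, so adaptivity
and the number of queries do not enter the union bound. -/
theorem isAccurate_of_noise_le (hn : 1 ≤ p.n) (hℓ : 1 ≤ p.ℓ) (α : ℝ) {β : ℝ} (hβ : 0 < β) {M : ℕ}
    (hM : 0 < M)
    (h : ∀ D : Fin p.n → L1Space p.ℓ, (∀ i, D i ∈ X) → ∀ ξ : ℕ → ℝ,
      (∀ a < M, |ξ a| ≤ 2 * Real.log (M / β)) → ∀ y ∈ X,
        |p.tuning.respond D ξ y - distanceAnswer D y| ≤ α) :
    (distanceQueryCode.mechanism p).IsAccurate tapeLaw X p.k α β := by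
  intro D hD A
  refine (measure_mono fun ω hω => ?_).trans (tapeLaw_exists_noise_gt M hβ hM)
  obtain ⟨j, hj⟩ := hω
  by_contra hne
  simp only [Set.mem_ofPred_eq, not_exists, not_and, not_lt] at hne
  rw [answerAt_eq hn hℓ] at hj
  exact absurd hj (not_lt.2 (h D hD _ hne _ (A.ask_mem _ _)))

end RamProgram

/-! ### Distances in coordinates -/

theorem dist_eq_sum_coord {ℓ : ℕ} (x y : L1Space ℓ) :
    dist x y = ∑ i ∈ Finset.range ℓ, |coord x i - coord y i| := by
  rw [PiLp.dist_eq_of_L1, Finset.sum_range]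
  refine Finset.sum_congr rfl fun i _ => ?_
  simp [coord, Real.dist_eq]

theorem distanceAnswer_eq_sum {n ℓ : ℕ} (D : Fin n → L1Space ℓ) (y : L1Space ℓ) :
    distanceAnswer D y = ∑ i ∈ Finset.range ℓ, ∑ j ∈ Finset.range n,
      |entry D j i - coord y i| / n := by
  rw [Finset.sum_comm, distanceAnswer, Finset.mul_sum, Finset.sum_range]
  refine Finset.sum_congr rfl fun j _ => ?_
  rw [dist_eq_sum_coord, Finset.mul_sum]
  refine Finset.sum_congr rfl fun i _ => ?_
  simp [entry]
  ring

theorem isBounded_unitCube (ℓ : ℕ) : Bornology.IsBounded (unitCube ℓ) := by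
  refine (Metric.isBounded_iff_subset_closedBall 0).2 ⟨ℓ, fun x hx => ?_⟩
  rw [Metric.mem_closedBall, PiLp.dist_eq_of_L1]
  calc ∑ i, dist (x i) ((0 : L1Space ℓ) i) ≤ ∑ _i : Fin ℓ, (1 : ℝ) := by
        refine Finset.sum_le_sum fun i _ => ?_
        have := hx i
        rw [PiLp.zero_apply, Real.dist_eq, sub_zero, abs_of_nonneg this.1]
        exact this.2
    _ = ℓ := by simp

theorem dist_le_one_of_diam {ℓ : ℕ} {X : Set (L1Space ℓ)} (hX : X ⊆ unitCube ℓ)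
    (hdiam : Metric.diam X ≤ 1) {x y : L1Space ℓ} (hx : x ∈ X) (hy : y ∈ X) : dist x y ≤ 1 :=
  (Metric.dist_le_diam_of_mem ((isBounded_unitCube ℓ).subset hX) hx hy).trans hdiam

theorem coord_mem_Icc {ℓ : ℕ} {x : L1Space ℓ} (hx : x ∈ unitCube ℓ) (i : ℕ) :
    coord x i ∈ Set.Icc (0 : ℝ) 1 := by
  unfold coord
  split_ifs with h
  · exact hx ⟨i, h⟩
  · simp

theorem distanceAnswer_mem_Icc {n ℓ : ℕ} (hn : 1 ≤ n) {X : Set (L1Space ℓ)} (hX : X ⊆ unitCube ℓ)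
    (hdiam : Metric.diam X ≤ 1) {D : Fin n → L1Space ℓ} (hD : ∀ i, D i ∈ X) {y : L1Space ℓ}
    (hy : y ∈ X) : distanceAnswer D y ∈ Set.Icc (0 : ℝ) 1 := by
  have hn' : (0 : ℝ) < n := by exact_mod_cast hn
  unfold distanceAnswer
  refine ⟨by positivity, ?_⟩
  rw [one_div, inv_mul_le_iff₀ hn', mul_one]
  calc ∑ j, dist (D j) y ≤ ∑ _j : Fin n, (1 : ℝ) :=
        Finset.sum_le_sum fun j _ => dist_le_one_of_diam hX hdiam (hD j) hy
    _ = n := by simp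

theorem abs_clip_sub_le {r v : ℝ} (hv : v ∈ Set.Icc (0 : ℝ) 1) :
    |max 0 (min 1 r) - v| ≤ min 1 |r - v| := by
  obtain ⟨h0, h1⟩ := hv
  refine le_min ?_ ?_
  · rw [abs_le]
    constructor
    · linarith [le_max_left 0 (min 1 r)]
    · linarith [max_le zero_le_one (min_le_left 1 r)]
  · rcases max_cases 0 (min 1 r) with ⟨h, h'⟩ | ⟨h, h'⟩ <;>
    rcases min_cases 1 r with ⟨g, g'⟩ | ⟨g, g'⟩ <;>
    rw [h] <;> cases abs_cases (r - v) <;> rw [abs_le] <;> constructor <;> linarith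

/-! ### Adjacent databases -/

theorem exists_of_adjacent {n ℓ : ℕ} (hn : 1 ≤ n) {D D' : Fin n → L1Space ℓ} (h : Adjacent D D') :
    ∃ j₀ : Fin n, ∀ j, j ≠ j₀ → D j = D' j := by
  have := Finset.card_le_one.1 h
  by_cases hD : ∃ j, D j ≠ D' j
  · obtain ⟨j₀, hj₀⟩ := hD
    refine ⟨j₀, fun j hj => ?_⟩
    by_contra hne
    exact hj (this j (by simpa using hne) j₀ (by simpa using hj₀))
  · push Not at hD
    exact ⟨⟨0, hn⟩, fun j _ => hD j⟩

theorem sum_entry_sub {n ℓ : ℕ} {D D' : Fin n → L1Space ℓ} {j₀ : Fin n}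
    (h : ∀ j, j ≠ j₀ → D j = D' j) (i : ℕ) (f : ℝ → ℝ) :
    ∑ j ∈ Finset.range n, (f (entry D j i) - f (entry D' j i)) =
      f (coord (D j₀) i) - f (coord (D' j₀) i) := by
  rw [Finset.sum_eq_single_of_mem (j₀ : ℕ) (Finset.mem_range.2 j₀.2)]
  · simp [entry]
  · intro j hj hne
    rw [Finset.mem_range] at hj
    simp [entry, hj, h ⟨j, hj⟩ fun e => hne (congrArg Fin.val e)]

theorem sum_range_mul (ℓ M : ℕ) (hℓ : 0 < ℓ) (f : ℕ → ℕ → ℝ) :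
    ∑ a ∈ Finset.range (M * ℓ), f (a / ℓ) (a % ℓ) =
      ∑ v ∈ Finset.range M, ∑ i ∈ Finset.range ℓ, f v i := by
  induction M with
  | zero => simp
  | succ M ih =>
    rw [Nat.succ_mul, Finset.sum_range_add, ih, Finset.sum_range_succ]
    congr 1
    refine Finset.sum_congr rfl fun i hi => ?_
    have hi' := Finset.mem_range.1 hi
    rw [mul_comm M ℓ, Nat.mul_add_div hℓ, Nat.div_eq_of_lt hi', Nat.mul_add_mod,
      Nat.mod_eq_of_lt hi', add_zero]

/-- Cell `a` belongs to coordinate `a % ℓ` of block `a / ℓ`, a data point or a node, so norms of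
shifts can be computed block by block. -/
theorem sum_finset_le_of_blocks {ℓ : ℕ} (hℓ : 0 < ℓ) {f : ℕ → ℕ → ℝ} (hf : ∀ v i, 0 ≤ f v i) {ε : ℝ}
    (h : ∀ M, ∑ v ∈ Finset.range M, ∑ i ∈ Finset.range ℓ, f v i ≤ ε) (s : Finset ℕ) :
    ∑ a ∈ s, f (a / ℓ) (a % ℓ) ≤ ε := by
  refine le_trans ?_ (h (s.sup id + 1))
  rw [← sum_range_mul _ _ hℓ]
  refine Finset.sum_le_sum_of_subset_of_nonneg (fun a ha => ?_) fun a _ _ => hf _ _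
  rw [Finset.mem_range]
  calc a < s.sup id + 1 := Nat.lt_succ_of_le (Finset.le_sup (f := id) ha)
    _ ≤ _ := Nat.le_mul_of_pos_right _ hℓ

/-! ### The shift for a noisy copy of the data -/

theorem exists_shift_data {n ℓ : ℕ} (hn : 1 ≤ n) (hℓ : 1 ≤ ℓ) {ε : ℝ} (hε : 0 < ε)
    {D D' : Fin n → L1Space ℓ} (hadj : Adjacent D D') (hdist : ∀ j, dist (D j) (D' j) ≤ 1) :
    ∃ c : ℕ → ℝ, (∀ s : Finset ℕ, ∑ a ∈ s, |c a| ≤ ε) ∧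
      ∀ ξ y, (⟨1 / ε, 0, 0, 0, 0⟩ : Tuning).respond D ξ y =
        (⟨1 / ε, 0, 0, 0, 0⟩ : Tuning).respond D' (fun a => ξ a + c a) y := by
  obtain ⟨j₀, hj₀⟩ := exists_of_adjacent hn hadj
  -- At scale `1 / ε` this shift moves the data of `D'` onto those of `D`, so the noisy copies
  -- coincide.
  refine ⟨fun a => (entry D (a / ℓ) (a % ℓ) - entry D' (a / ℓ) (a % ℓ)) * ε, ?_, fun ξ y => ?_⟩
  · refine sum_finset_le_of_blocks hℓ
      (f := fun v i => |(entry D v i - entry D' v i) * ε|) (fun _ _ => abs_nonneg _) fun M => ?_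
    calc _ ≤ ∑ v ∈ Finset.range M, if v = j₀ then ε else 0 := by
          refine Finset.sum_le_sum fun v _ => ?_
          split_ifs with hv
          · simp only [abs_mul, ← Finset.sum_mul, abs_of_pos hε]
            refine mul_le_of_le_one_left hε.le (le_trans (le_of_eq ?_) (hdist j₀))
            rw [dist_eq_sum_coord]
            simp [entry, hv]
          · refine (Finset.sum_eq_zero fun i _ => ?_).le
            unfold entry
            split_ifs with hvn
            · rw [hj₀ ⟨v, hvn⟩ fun e => hv (congrArg Fin.val e)]
              simp
            · simp
      _ ≤ ε := by
          rw [Finset.sum_ite_eq']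
          split_ifs
          exacts [le_rfl, hε.le]
  · unfold Tuning.respond Tuning.rawAnswer Tuning.term
    congr 3
    · refine Finset.sum_congr rfl fun i hi => ?_
      simp only [mul_zero, zero_add]
      refine Finset.sum_congr rfl fun j _ => ?_
      have hi' := Finset.mem_range.1 hi
      have e1 : (j * ℓ + i) / ℓ = j := by
        rw [mul_comm, Nat.mul_add_div hℓ, Nat.div_eq_of_lt hi', add_zero]
      have e2 : (j * ℓ + i) % ℓ = i := by
        rw [mul_comm, Nat.mul_add_mod, Nat.mod_eq_of_lt hi']
      simp only [e1, e2, Tuning.place]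
      congr 2
      field_simp
      ring
    · simp

/-! ### The shift for a single noisy answer -/

theorem exists_shift_answer {n ℓ : ℕ} (hn : 1 ≤ n) {ε : ℝ} (hε : 0 < ε)
    {D D' : Fin n → L1Space ℓ} (hadj : Adjacent D D') (hdist : ∀ j, dist (D j) (D' j) ≤ 1)
    (y : L1Space ℓ) :
    ∃ c : ℕ → ℝ, (∀ s : Finset ℕ, ∑ a ∈ s, |c a| ≤ ε) ∧
      ∀ ξ, (⟨0, 0, 1 / (n * ε), 0, 0⟩ : Tuning).respond D ξ y =
        (⟨0, 0, 1 / (n * ε), 0, 0⟩ : Tuning).respond D' (fun a => ξ a + c a) y := by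
  obtain ⟨j₀, hj₀⟩ := exists_of_adjacent hn hadj
  have hn' : (0 : ℝ) < n := by exact_mod_cast hn
  have hraw : ∀ (B : Fin n → L1Space ℓ) ξ, (⟨0, 0, 1 / (n * ε), 0, 0⟩ : Tuning).rawAnswer B ξ y =
      distanceAnswer B y + ξ 0 * (1 / (n * ε)) := by
    intro B ξ
    rw [distanceAnswer_eq_sum]
    simp [Tuning.rawAnswer, Tuning.term, Tuning.place]
  set d := distanceAnswer D y - distanceAnswer D' y with hd
  have hdn : |d| * n ≤ 1 := by
    have e : d * n = dist (D j₀) y - dist (D' j₀) y := by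
      rw [hd, distanceAnswer, distanceAnswer, ← mul_sub, ← Finset.sum_sub_distrib,
        Finset.sum_eq_single_of_mem j₀ (Finset.mem_univ _) fun j _ hj => by rw [hj₀ j hj, sub_self]]
      field_simp
    rw [← abs_of_pos hn', ← abs_mul, e]
    exact (abs_dist_sub_le _ _ _).trans (hdist j₀)
  refine ⟨fun a => if a = 0 then d * (n * ε) else 0, fun s => ?_, fun ξ => ?_⟩
  · have h0 : |d * (n * ε)| ≤ ε := by
      rw [abs_mul, abs_of_pos (mul_pos hn' hε), ← mul_assoc]
      exact mul_le_of_le_one_left hε.le hdn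
    simp only [apply_ite abs, abs_zero]
    rw [Finset.sum_ite_eq']
    split_ifs
    exacts [h0, hε.le]
  · unfold Tuning.respond
    rw [hraw, hraw]
    congr 2
    simp only [if_true]
    rw [hd]
    field_simp
    ring

/-! ### The tree of dyadic points -/

theorem descent_fst_div_two (y : ℝ) (m : ℕ) : (descent y (m + 1)).1 / 2 = (descent y m).1 := by
  rw [descent]
  split_ifs <;> simp only <;> omega

theorem two_pow_le_descent_fst (y : ℝ) (m : ℕ) : 2 ^ m ≤ (descent y m).1 := by
  induction m with
  | zero => exact le_rfl
  | succ m ih =>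
    have := descent_fst_div_two y m
    rw [pow_succ]
    omega

theorem descent_fst_lt (y : ℝ) (m : ℕ) : (descent y m).1 < 2 ^ (m + 1) := by
  induction m with
  | zero => simp [descent]
  | succ m ih =>
    have := descent_fst_div_two y m
    rw [pow_succ]
    omega

theorem descent_add (y : ℝ) (m : ℕ) :
    ((descent y m).1 : ℝ) * (2 / 2 ^ m) - 2 = y - (descent y m).2 := by
  induction m with
  | zero => simp [descent]
  | succ m ih =>
    have e : (2 : ℝ) / 2 ^ m = 2 * (2 / 2 ^ (m + 1)) := by rw [pow_succ]; field_simp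
    rw [e] at ih
    rw [descent]
    split_ifs <;> push_cast <;> linarith

theorem descent_snd_mem_Icc {y : ℝ} (hy : y ∈ Set.Icc (0 : ℝ) 1) (m : ℕ) :
    (descent y m).2 ∈ Set.Icc (0 : ℝ) (2 / 2 ^ m) := by
  induction m with
  | zero =>
    simp only [descent, pow_zero, div_one]
    exact ⟨hy.1, by linarith [hy.2]⟩
  | succ m ih =>
    have e : (2 : ℝ) / 2 ^ m = 2 * (2 / 2 ^ (m + 1)) := by rw [pow_succ]; field_simp
    rw [e] at ih
    obtain ⟨h0, h1⟩ := ih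
    rw [descent]
    split_ifs with h
    · exact ⟨h0, h.le⟩
    · exact ⟨by simp only; linarith, by simp only; linarith⟩

/-- The point of `[0,1]` at which the interval of the node `v ≥ 2` begins. -/
noncomputable def gridPoint (v : ℕ) : ℝ := v * (2 / 2 ^ Nat.log 2 v) - 2

theorem gridPoint_two_pow_add {m q : ℕ} (hq : q < 2 ^ m) :
    gridPoint (2 ^ m + q) = q * (2 / 2 ^ m) := by
  have : Nat.log 2 (2 ^ m + q) = m := by
    refine Nat.log_eq_of_pow_le_of_lt_pow (Nat.le_add_right _ _) ?_
    rw [pow_succ]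
    omega
  rw [gridPoint, this]
  push_cast
  field_simp
  ring

theorem gridPoint_descent (y : ℝ) (m : ℕ) : gridPoint (descent y m).1 = y - (descent y m).2 := by
  rw [gridPoint, Nat.log_eq_of_pow_le_of_lt_pow (two_pow_le_descent_fst y m) (descent_fst_lt y m),
    descent_add]

/-- The difference of the distances from `x` and `x'`. -/
def distDiff (x x' y : ℝ) : ℝ := |x - y| - |x' - y|

theorem abs_distDiff_le (x x' y : ℝ) : |distDiff x x' y| ≤ |x - x'| := by
  refine (abs_abs_sub_abs_le _ _).trans (le_of_eq ?_)
  congr 1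
  ring

/-- The value is `x - x'` to the left of `x`, `x' - x` to the right of `x'`, with slope `2` between.
Monotonicity keeps the cost of a level independent of its number of nodes. -/
theorem distDiff_monotone {x x' : ℝ} (h : x ≤ x') : Monotone (distDiff x x') := by
  intro a b hab
  unfold distDiff
  cases abs_cases (x - a) <;> cases abs_cases (x - b) <;> cases abs_cases (x' - a) <;>
    cases abs_cases (x' - b) <;> linarith

theorem sum_abs_distDiff_le (x x' : ℝ) {t : ℕ → ℝ} (ht : Monotone t) (N : ℕ) :
    ∑ q ∈ Finset.range N, |distDiff x x' (t (q + 1)) - distDiff x x' (t q)| ≤ 2 * |x - x'| := by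
  wlog h : x ≤ x' generalizing x x'
  · refine le_trans (le_of_eq ?_) ((this x' x (le_of_not_ge h)).trans_eq (by rw [abs_sub_comm]))
    refine Finset.sum_congr rfl fun q _ => ?_
    rw [abs_sub_comm]
    congr 1
    unfold distDiff
    ring
  have hmono : ∀ q, |distDiff x x' (t (q + 1)) - distDiff x x' (t q)| =
      distDiff x x' (t (q + 1)) - distDiff x x' (t q) := fun q =>
    abs_of_nonneg (sub_nonneg.2 (distDiff_monotone h (ht (Nat.le_succ q))))
  simp only [hmono]
  rw [Finset.sum_range_sub (fun q => distDiff x x' (t q))]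
  have h1 := (abs_le.1 (abs_distDiff_le x x' (t N))).2
  have h2 := (abs_le.1 (abs_distDiff_le x x' (t 0))).1
  linarith

/-- The difference of the distances from `x` and `x'` at the node `v`, and `0` at the root. -/
noncomputable def nodeDiff (x x' : ℝ) (v : ℕ) : ℝ :=
  if v < 2 then 0 else distDiff x x' (gridPoint v)

/-- A left child begins where its parent does, a right child one grid step later, so a level costs
at most the variation of `distDiff` along the grid. -/
theorem sum_level_nodeDiff_le (x x' : ℝ) (m : ℕ) :
    ∑ q ∈ Finset.range (2 ^ (m + 1)), |nodeDiff x x' (2 ^ (m + 1) + q) -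
      nodeDiff x x' ((2 ^ (m + 1) + q) / 2)| ≤ 2 * |x - x'| := by
  have hdiv : ∀ q, (2 ^ (m + 1) + q) / 2 = 2 ^ m + q / 2 := by
    intro q
    rw [pow_succ]
    omega
  have hbig : ∀ q, ¬ 2 ^ (m + 1) + q < 2 := by
    intro q
    rw [pow_succ]
    have := Nat.one_le_two_pow (n := m)
    omega
  rcases Nat.eq_zero_or_pos m with rfl | hm
  -- The root has value `0`, so each of its two children may cost a full `|x - x'|`.
  · have h1 : ∀ q < 2, |nodeDiff x x' (2 ^ (0 + 1) + q) - nodeDiff x x' ((2 ^ (0 + 1) + q) / 2)| ≤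
        |x - x'| := by
      intro q hq
      rw [hdiv, nodeDiff, nodeDiff, if_neg (hbig q), if_pos (by simp; omega), sub_zero]
      exact abs_distDiff_le _ _ _
    refine (Finset.sum_le_card_nsmul _ _ |x - x'| fun q hq => h1 q (by simpa using hq)).trans ?_
    simp
  -- The point of the node `q` is `t (q + 1)`; the shift by one gives `q = 0` a predecessor too.
  · set t : ℕ → ℝ := fun q => ((q : ℝ) - 1) * (2 / 2 ^ (m + 1)) with ht
    have htm : Monotone t := by
      intro a b hab
      have : (a : ℝ) ≤ b := by exact_mod_cast hab
      simp only [ht]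
      gcongr
    refine le_trans (Finset.sum_le_sum fun q hq => ?_) (sum_abs_distDiff_le x x' htm (2 ^ (m + 1)))
    have hq' := Finset.mem_range.1 hq
    have hq2 : q / 2 < 2 ^ m := by
      rw [pow_succ] at hq'
      omega
    have hm2 : ¬ 2 ^ m + q / 2 < 2 := by
      have := Nat.pow_le_pow_right (n := 2) (by norm_num) hm
      omega
    rw [hdiv, nodeDiff, nodeDiff, if_neg (hbig q), if_neg hm2, gridPoint_two_pow_add hq',
      gridPoint_two_pow_add hq2]
    have e1 : (q : ℝ) * (2 / 2 ^ (m + 1)) = t (q + 1) := by simp [ht]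
    rcases Nat.even_or_odd' q with ⟨r, rfl | rfl⟩
    · have e2 : (((2 * r / 2 : ℕ) : ℝ)) * (2 / 2 ^ m) = t (2 * r + 1) := by
        rw [Nat.mul_div_cancel_left _ (by norm_num), ← e1, pow_succ]
        push_cast
        field_simp
      rw [e1, e2, sub_self, abs_zero]
      exact abs_nonneg _
    · have e2 : ((((2 * r + 1) / 2 : ℕ) : ℝ)) * (2 / 2 ^ m) = t (2 * r + 1) := by
        rw [show (2 * r + 1) / 2 = r by omega]
        simp only [ht]
        rw [pow_succ]
        push_cast
        field_simp
        ring
      rw [e1, e2]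

theorem sum_nodeDiff_le (x x' : ℝ) (d : ℕ) :
    ∑ v ∈ Finset.range (2 ^ (d + 1)), |nodeDiff x x' v - nodeDiff x x' (v / 2)| ≤
      d * (2 * |x - x'|) := by
  induction d with
  | zero => simp [Finset.sum_range_succ, nodeDiff]
  | succ d ih =>
    rw [pow_succ 2 (d + 1), mul_two, Finset.sum_range_add]
    refine (add_le_add ih (sum_level_nodeDiff_le x x' d)).trans (le_of_eq ?_)
    push_cast
    ring

/-- Telescoping; the value `0` at the root leaves the full value at the rounded query. -/
theorem sum_path_nodeDiff (x x' y : ℝ) {d : ℕ} (hd : 0 < d) :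
    ∑ m ∈ Finset.range d, (nodeDiff x x' (descent y (m + 1)).1 -
      nodeDiff x x' ((descent y (m + 1)).1 / 2)) = distDiff x x' (y - (descent y d).2) := by
  have h2 : ¬ (descent y d).1 < 2 := by
    have h1 := two_pow_le_descent_fst y d
    have := Nat.pow_le_pow_right (n := 2) (by norm_num) hd
    omega
  simp only [descent_fst_div_two]
  rw [Finset.sum_range_sub (fun m => nodeDiff x x' (descent y m).1), nodeDiff, if_neg h2,
    gridPoint_descent, nodeDiff, if_pos (by simp [descent]), sub_zero]

/-! ### The shift for noisy trees -/

theorem exists_shift_tree {n ℓ d : ℕ} (hn : 1 ≤ n) (hℓ : 1 ≤ ℓ) (hd : 0 < d) {ε : ℝ} (hε : 0 < ε)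
    {D D' : Fin n → L1Space ℓ} (hadj : Adjacent D D') (hdist : ∀ j, dist (D j) (D' j) ≤ 1) :
    ∃ c : ℕ → ℝ, (∀ s : Finset ℕ, ∑ a ∈ s, |c a| ≤ ε) ∧
      ∀ ξ y, (⟨0, (d : ℝ) * 2 / (n * ε), 0, 1, d⟩ : Tuning).respond D ξ y =
        (⟨0, (d : ℝ) * 2 / (n * ε), 0, 1, d⟩ : Tuning).respond D' (fun a => ξ a + c a) y := by
  obtain ⟨j₀, hj₀⟩ := exists_of_adjacent hn hadj
  have hn' : (0 : ℝ) < n := by exact_mod_cast hn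
  have hd' : (0 : ℝ) < d := by exact_mod_cast hd
  set x := coord (D j₀)
  set x' := coord (D' j₀)
  set g : ℕ → ℕ → ℝ := fun v i =>
    (nodeDiff (x i) (x' i) v - nodeDiff (x i) (x' i) (v / 2)) * (ε / (2 * d)) with hg
  -- Nodes below depth `d` lie on no path and stay unshifted. The factor `ε / (2 d)` inverts the
  -- noise scale up to the weight `1 / n` of a data point.
  refine ⟨fun a => if a / ℓ < 2 ^ (d + 1) then g (a / ℓ) (a % ℓ) else 0, ?_, fun ξ y => ?_⟩
  · refine sum_finset_le_of_blocks hℓ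
      (f := fun v i => |if v < 2 ^ (d + 1) then g v i else 0|) (fun _ _ => abs_nonneg _) fun M => ?_
    calc _ = ∑ v ∈ Finset.range M with v < 2 ^ (d + 1), ∑ i ∈ Finset.range ℓ, |g v i| := by
          rw [Finset.sum_filter]
          refine Finset.sum_congr rfl fun v _ => ?_
          split_ifs
          · rfl
          · simp
      _ ≤ ∑ v ∈ Finset.range (2 ^ (d + 1)), ∑ i ∈ Finset.range ℓ, |g v i| := by
          refine Finset.sum_le_sum_of_subset_of_nonneg (fun v hv => ?_) fun _ _ _ =>
            Finset.sum_nonneg fun _ _ => abs_nonneg _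
          exact Finset.mem_range.2 (Finset.mem_filter.1 hv).2
      _ = ∑ i ∈ Finset.range ℓ, (∑ v ∈ Finset.range (2 ^ (d + 1)),
            |nodeDiff (x i) (x' i) v - nodeDiff (x i) (x' i) (v / 2)|) * (ε / (2 * d)) := by
          rw [Finset.sum_comm]
          refine Finset.sum_congr rfl fun i _ => ?_
          rw [Finset.sum_mul]
          refine Finset.sum_congr rfl fun v _ => ?_
          rw [hg, abs_mul, abs_of_pos (a := ε / (2 * d)) (by positivity)]
      _ ≤ ∑ i ∈ Finset.range ℓ, (d * (2 * |x i - x' i|)) * (ε / (2 * d)) := by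
          gcongr with i
          exact sum_nodeDiff_le _ _ _
      _ = dist (D j₀) (D' j₀) * ε := by
          rw [dist_eq_sum_coord, Finset.sum_mul]
          refine Finset.sum_congr rfl fun i _ => ?_
          field_simp
          rfl
      _ ≤ ε := mul_le_of_le_one_left hε.le (hdist j₀)
  · unfold Tuning.respond Tuning.rawAnswer
    congr 3
    · refine Finset.sum_congr rfl fun i hi => ?_
      have hi' := Finset.mem_range.1 hi
      set yi := coord y i
      have hpath : ∑ m ∈ Finset.range d, (if ((descent yi (m + 1)).1 * ℓ + i) / ℓ < 2 ^ (d + 1) then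
          g (((descent yi (m + 1)).1 * ℓ + i) / ℓ) (((descent yi (m + 1)).1 * ℓ + i) % ℓ) else 0) =
          distDiff (x i) (x' i) (yi - (descent yi d).2) * (ε / (2 * d)) := by
        rw [← sum_path_nodeDiff _ _ _ hd, Finset.sum_mul]
        refine Finset.sum_congr rfl fun m hm => ?_
        have hm' := Finset.mem_range.1 hm
        have e1 : ((descent yi (m + 1)).1 * ℓ + i) / ℓ = (descent yi (m + 1)).1 := by
          rw [mul_comm, Nat.mul_add_div hℓ, Nat.div_eq_of_lt hi', add_zero]
        have e2 : ((descent yi (m + 1)).1 * ℓ + i) % ℓ = i := by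
          rw [mul_comm, Nat.mul_add_mod, Nat.mod_eq_of_lt hi']
        rw [e1, e2, if_pos]
        exact (descent_fst_lt yi (m + 1)).trans_le (Nat.pow_le_pow_right (by norm_num) (by omega))
      have hterm := sum_entry_sub hj₀ i fun z => |z - (yi - (descent yi d).2)|
      rw [Finset.sum_sub_distrib] at hterm
      simp only [Tuning.pathNoise, Tuning.term, Tuning.place, Finset.sum_add_distrib, hpath,
        mul_zero, add_zero, mul_one, ← Finset.sum_div]
      rw [sub_eq_iff_eq_add.1 hterm, distDiff]
      field_simp
      ring
    · simp

/-! ### The error of the answers -/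

theorem abs_rawAnswer_sub_le {n ℓ : ℕ} (τ : Tuning) (D : Fin n → L1Space ℓ) (ξ : ℕ → ℝ)
    (y : L1Space ℓ) :
    |τ.rawAnswer D ξ y - distanceAnswer D y| ≤
      ∑ i ∈ Finset.range ℓ, (|τ.pathNoise ℓ ξ i (coord y i)| * |τ.nodeScale| +
        ∑ j ∈ Finset.range n, (|ξ (j * ℓ + i)| * |τ.dataScale| +
          |(descent (coord y i) τ.depth).2| * |τ.rounding|) / n) + |ξ 0| * |τ.answerScale| := by
  rw [Tuning.rawAnswer, distanceAnswer_eq_sum, add_sub_right_comm, ← Finset.sum_sub_distrib]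
  refine (abs_add_le _ _).trans (add_le_add ((Finset.abs_sum_le_sum_abs _ _).trans
    (Finset.sum_le_sum fun i _ => ?_)) (abs_mul _ _).le)
  rw [add_sub_assoc, ← Finset.sum_sub_distrib]
  refine (abs_add_le _ _).trans (add_le_add (abs_mul _ _).le ((Finset.abs_sum_le_sum_abs _ _).trans
    (Finset.sum_le_sum fun j _ => ?_)))
  rw [Tuning.term, ← sub_div, abs_div, Nat.abs_cast, ← abs_mul, ← abs_mul]
  gcongr
  refine (abs_abs_sub_abs_le _ _).trans (le_trans (le_of_eq ?_) (abs_add_le _ _))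
  congr 1
  rw [Tuning.place]
  ring

theorem abs_rawAnswer_sub_le_of_data {n ℓ : ℕ} (hn : 1 ≤ n) (D : Fin n → L1Space ℓ) {ξ : ℕ → ℝ}
    {b B : ℝ} (hb : 0 ≤ b) (hξ : ∀ a < n * ℓ, |ξ a| ≤ B) (y : L1Space ℓ) :
    |(⟨b, 0, 0, 0, 0⟩ : Tuning).rawAnswer D ξ y - distanceAnswer D y| ≤ ℓ * (B * b) := by
  have hn' : (0 : ℝ) < n := by exact_mod_cast hn
  refine (abs_rawAnswer_sub_le _ D ξ y).trans ?_
  simp only [abs_zero, mul_zero, zero_add, add_zero, abs_of_nonneg hb]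
  calc _ ≤ ∑ i ∈ Finset.range ℓ, ∑ j ∈ Finset.range n, B * b / n := by
        gcongr with i hi j hj
        refine hξ _ ?_
        rw [Finset.mem_range] at hi hj
        calc j * ℓ + i < j * ℓ + ℓ := by omega
          _ = (j + 1) * ℓ := by ring
          _ ≤ n * ℓ := by gcongr; omega
    _ = ℓ * (B * b) := by
        simp only [Finset.sum_const, Finset.card_range, nsmul_eq_mul]
        field_simp

theorem abs_rawAnswer_sub_le_of_tree {n ℓ : ℕ} (hn : 1 ≤ n) (D : Fin n → L1Space ℓ) {ξ : ℕ → ℝ}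
    {c B : ℝ} (hc : 0 ≤ c) {d : ℕ} (hξ : ∀ a < 2 ^ (d + 1) * ℓ, |ξ a| ≤ B) {y : L1Space ℓ}
    (hy : y ∈ unitCube ℓ) :
    |(⟨0, c, 0, 1, d⟩ : Tuning).rawAnswer D ξ y - distanceAnswer D y| ≤
      ℓ * (d * B * c + 2 / 2 ^ d) := by
  have hn' : (0 : ℝ) < n := by exact_mod_cast hn
  refine (abs_rawAnswer_sub_le _ D ξ y).trans ?_
  simp only [abs_zero, mul_zero, zero_add, add_zero, abs_of_nonneg hc, abs_one, mul_one]
  calc _ ≤ ∑ i ∈ Finset.range ℓ, (d * B * c + ∑ j ∈ Finset.range n, (2 / 2 ^ d : ℝ) / n) := by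
        gcongr with i hi j hj
        · refine (Finset.abs_sum_le_sum_abs _ _).trans ((Finset.sum_le_card_nsmul _ _ B
            fun m hm => hξ _ ?_).trans (by simp))
          rw [Finset.mem_range] at hi hm
          have hm' : m < d := hm
          have h1 := descent_fst_lt (coord y i) (m + 1)
          calc (descent (coord y i) (m + 1)).1 * ℓ + i
              < (descent (coord y i) (m + 1)).1 * ℓ + ℓ := by omega
            _ = ((descent (coord y i) (m + 1)).1 + 1) * ℓ := by ring
            _ ≤ 2 ^ (m + 1 + 1) * ℓ := by gcongr; omega
            _ ≤ 2 ^ (d + 1) * ℓ := by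
              gcongr
              · norm_num
              · omega
        · have := descent_snd_mem_Icc (coord_mem_Icc hy i) d
          rw [abs_of_nonneg this.1]
          exact this.2
    _ = ℓ * (d * B * c + 2 / 2 ^ d) := by
        simp only [Finset.sum_const, Finset.card_range, nsmul_eq_mul]
        field_simp

theorem abs_rawAnswer_sub_le_of_answer {n ℓ : ℕ} (D : Fin n → L1Space ℓ) {ξ : ℕ → ℝ}
    {a B : ℝ} (ha : 0 ≤ a) (hξ : |ξ 0| ≤ B) (y : L1Space ℓ) :
    |(⟨0, 0, a, 0, 0⟩ : Tuning).rawAnswer D ξ y - distanceAnswer D y| ≤ B * a := by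
  refine (abs_rawAnswer_sub_le _ D ξ y).trans ?_
  simp only [abs_zero, mul_zero, zero_add, add_zero, abs_of_nonneg ha, zero_div,
    Finset.sum_const_zero]
  gcongr

/-! ### Estimates -/

theorem two_pow_digits_succ_le {t : ℝ} (ht0 : 0 < t) (ht1 : t ≤ 1) :
    (2 : ℝ) ^ (digits t + 1) ≤ 4 / t := by
  rw [le_div_iff₀ ht0]
  rcases h : digits t with _ | J
  · norm_num
    linarith
  · have := lt_of_lt_digits (h.symm ▸ Nat.lt_succ_self J : J < digits t)
    rw [lt_div_iff₀ (by positivity)] at this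
    rw [pow_succ, pow_succ]
    linarith

theorem one_le_log_four_div {t : ℝ} (ht0 : 0 < t) (ht1 : t ≤ 1) : 1 ≤ Real.log (4 / t) := by
  rw [Real.le_log_iff_exp_le (by positivity), le_div_iff₀ ht0]
  have := Real.exp_one_lt_d9
  nlinarith [Real.exp_pos 1]

theorem digits_succ_le {t : ℝ} (ht0 : 0 < t) (ht1 : t ≤ 1) :
    ((digits t + 1 : ℕ) : ℝ) ≤ 2 * Real.log (4 / t) := by
  have h := Real.log_le_log (by positivity) (two_pow_digits_succ_le ht0 ht1)
  rw [Real.log_pow] at h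
  have := Real.log_two_gt_d9
  have h2 : (0 : ℝ) ≤ ((digits t + 1 : ℕ) : ℝ) := Nat.cast_nonneg _
  nlinarith

/-- Since `1 ≤ 2 L`, the terms are at most `6 Λ L`, `2 v Λ L` and `Λ L`. The factor `L` produced
here cancels against the noise scale `t / L`. -/
theorem log_estimate {Λ v L : ℝ} (hΛ : 1 ≤ Λ) (hv : 0 ≤ v) (hL : 1 / 2 ≤ L) :
    3 * Λ + v + L ≤ 7 * (1 + v) * Λ * L := by
  have h1 : 0 ≤ v * Λ := by positivity
  have h2 : v ≤ v * Λ := le_mul_of_one_le_right hv hΛ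
  nlinarith [mul_nonneg (sub_nonneg.2 hL) (by linarith : (0 : ℝ) ≤ Λ), mul_nonneg (sub_nonneg.2 hL) h1,
    mul_nonneg (sub_nonneg.2 hΛ) (by linarith : (0 : ℝ) ≤ L)]

/-- The error of the mechanism up to a constant factor, if `log (k / β) / (n ε) = t`. -/
noncomputable def errorScale (ℓ : ℕ) (t : ℝ) : ℝ :=
  ℓ * (1 + Real.log ℓ) * Real.log (4 / t) ^ 3 * t

theorem errorScale_le {ℓ : ℕ} (hℓ : 1 ≤ ℓ) {t : ℝ} (ht0 : 0 < t) (ht1 : t ≤ 1) :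
    errorScale ℓ t ≤ 40500 * ((ℓ : ℝ) ^ (9 / 5 : ℝ) * t ^ (4 / 5 : ℝ)) := by
  have hℓ' : (1 : ℝ) ≤ ℓ := by exact_mod_cast hℓ
  have hℓ0 : (0 : ℝ) < ℓ := by linarith
  have h1 : 1 + Real.log ℓ ≤ 3 * (ℓ : ℝ) ^ (4 / 5 : ℝ) := by
    have := Real.log_le_rpow_div hℓ0.le (show (0 : ℝ) < 4 / 5 by norm_num)
    have h2 := Real.one_le_rpow hℓ' (show (0 : ℝ) ≤ 4 / 5 by norm_num)
    linarith
  -- From `log x ≤ 15 x^(1/15)`, whose cube loses exactly the available `t^(-1/5)`; `13500 = 15^3 *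
  -- 4`.
  have h2 : Real.log (4 / t) ^ 3 ≤ 13500 * t ^ (-(1 / 5) : ℝ) := by
    have h3 := Real.log_le_rpow_div (x := 4 / t) (by positivity)
      (show (0 : ℝ) < 1 / 15 by norm_num)
    have h4 := one_le_log_four_div ht0 ht1
    have h5 : ((4 / t) ^ (1 / 15 : ℝ)) ^ 3 = (4 / t) ^ (1 / 5 : ℝ) := by
      rw [← Real.rpow_natCast, ← Real.rpow_mul (by positivity)]
      norm_num
    have h6 : (4 : ℝ) ^ (1 / 5 : ℝ) ≤ 4 := by
      calc (4 : ℝ) ^ (1 / 5 : ℝ) ≤ 4 ^ (1 : ℝ) :=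
            Real.rpow_le_rpow_of_exponent_le (by norm_num) (by norm_num)
        _ = 4 := Real.rpow_one 4
    calc Real.log (4 / t) ^ 3 ≤ ((4 / t) ^ (1 / 15 : ℝ) / (1 / 15)) ^ 3 := by gcongr
      _ = 3375 * (4 / t) ^ (1 / 5 : ℝ) := by
          rw [div_pow, h5]
          ring
      _ = 3375 * (4 ^ (1 / 5 : ℝ) * t ^ (-(1 / 5) : ℝ)) := by
          rw [Real.div_rpow (by norm_num) ht0.le, Real.rpow_neg ht0.le]
          rfl
      _ ≤ 3375 * (4 * t ^ (-(1 / 5) : ℝ)) := by gcongr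
      _ = _ := by ring
  have h7 : t ^ (4 / 5 : ℝ) = t ^ (-(1 / 5) : ℝ) * t := by
    conv_rhs => rw [← Real.rpow_one t, ← Real.rpow_mul ht0.le, ← Real.rpow_add ht0]
    norm_num
  have h8 : (ℓ : ℝ) ^ (9 / 5 : ℝ) = ℓ * (ℓ : ℝ) ^ (4 / 5 : ℝ) := by
    rw [← Real.rpow_one_add' hℓ0.le (by norm_num)]
    norm_num
  have hlog := Real.log_nonneg hℓ'
  have h4 := one_le_log_four_div ht0 ht1
  calc errorScale ℓ t ≤ ℓ * (3 * (ℓ : ℝ) ^ (4 / 5 : ℝ)) * (13500 * t ^ (-(1 / 5) : ℝ)) * t := by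
        unfold errorScale
        gcongr
    _ = _ := by
        rw [h7, h8]
        ring

/-! ### The error for valid parameters. -/

/-- The conditions on the public parameters, apart from `δ`. -/
structure ReleaseParams.Valid (p : ReleaseParams) : Prop where
  n : 1 ≤ p.n
  ℓ : 1 ≤ p.ℓ
  k : 1 ≤ p.k
  ε : 0 < p.ε
  β : 0 < p.β
  β_lt : p.β < 1

namespace ReleaseParams.Valid

variable {p : ReleaseParams}

theorem n_pos (hp : p.Valid) : (0 : ℝ) < p.n := by exact_mod_cast hp.n

theorem log_pos (hp : p.Valid) : 0 < Real.log (p.k / p.β) := by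
  refine Real.log_pos ((one_lt_div hp.β).2 (hp.β_lt.trans_le ?_))
  exact_mod_cast hp.k

theorem ratio_pos (hp : p.Valid) : 0 < p.ratio :=
  div_pos hp.log_pos (mul_pos hp.n_pos hp.ε)

theorem log_inv_le (hp : p.Valid) : -Real.log p.β ≤ Real.log (p.k / p.β) := by
  have hk : (1 : ℝ) ≤ p.k := by exact_mod_cast hp.k
  rw [Real.log_div (by linarith) hp.β.ne']
  linarith [Real.log_nonneg hk]

theorem half_le_log (hp : p.Valid) (hk : 1 < p.k) : 1 / 2 ≤ Real.log (p.k / p.β) := by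
  have hk' : (2 : ℝ) ≤ p.k := by exact_mod_cast hk
  have h1 := Real.log_le_log two_pos hk'
  have h2 := Real.log_two_gt_d9
  rw [Real.log_div (by linarith) hp.β.ne']
  linarith [Real.log_neg hp.β hp.β_lt]

theorem ratio_mul (hp : p.Valid) : p.ratio * (p.n * p.ε) = Real.log (p.k / p.β) :=
  div_mul_cancel₀ _ (mul_pos hp.n_pos hp.ε).ne'

/-- If the noise is not exceptionally large, then the error is at most a constant multiple of
`errorScale`. -/
theorem exists_noise_bound (hp : p.Valid) (ht : p.ratio ≤ 1) :
    ∃ M : ℕ, 0 < M ∧ ∀ D : Fin p.n → L1Space p.ℓ, ∀ ξ : ℕ → ℝ,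
      (∀ a < M, |ξ a| ≤ 2 * Real.log (M / p.β)) → ∀ y ∈ unitCube p.ℓ,
        |p.tuning.rawAnswer D ξ y - distanceAnswer D y| ≤ 113 * errorScale p.ℓ p.ratio := by
  have ht0 := hp.ratio_pos
  have hn := hp.n_pos
  have hε := hp.ε
  have hℓ : (1 : ℝ) ≤ p.ℓ := by exact_mod_cast hp.ℓ
  have hβ := hp.β
  have hℓ0 : (p.ℓ : ℝ) ≠ 0 := by positivity
  have hlogℓ := Real.log_nonneg hℓ
  have hL0 := hp.log_pos
  have hβL := hp.log_inv_le
  have hmul := hp.ratio_mul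
  set t := p.ratio
  set L := Real.log (p.k / p.β) with hLdef
  have hΛ := one_le_log_four_div ht0 ht
  set Λ := Real.log (4 / t) with hΛdef
  set v := Real.log p.ℓ
  have hinv : 1 / (p.n * p.ε) = t / L := by
    rw [← hmul]
    field_simp
  have hE : errorScale p.ℓ t = p.ℓ * ((1 + v) * Λ ^ 3 * t) := by
    rw [errorScale]
    ring
  rw [hE]
  have hsmall : t ≤ (1 + v) * Λ ^ 3 * t :=
    le_mul_of_one_le_left ht0.le (one_le_mul_of_one_le_of_one_le (by linarith) (one_le_pow₀ hΛ))
  unfold ReleaseParams.tuning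
  split_ifs with hk hlarge
  · have hL := hp.half_le_log hk
    refine ⟨p.n * p.ℓ, Nat.mul_pos hp.n hp.ℓ, fun D ξ hξ y _ => ?_⟩
    refine (abs_rawAnswer_sub_le_of_data hp.n D (by positivity) hξ y).trans ?_
    -- Here `t < e^(-n)`, so the factor `n` between the scales `1 / ε` and `1 / (n ε)` is only a
    -- logarithm.
    have hnΛ : (p.n : ℝ) ≤ Λ := by
      have h1 := Real.log_lt_log ht0 hlarge
      rw [Real.log_exp] at h1
      rw [hΛdef, Real.log_div (by norm_num) ht0.ne']
      linarith [Real.log_nonneg (show (1 : ℝ) ≤ 4 by norm_num)]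
    have hB : Real.log (((p.n * p.ℓ : ℕ) : ℝ) / p.β) ≤ 3 * Λ + v + L := by
      rw [Real.log_div (by rw [Nat.cast_mul]; positivity) hβ.ne', Nat.cast_mul, Real.log_mul hn.ne' hℓ0]
      linarith [Real.log_le_self hn.le]
    have hb : 1 / p.ε = p.n * (t / L) := by
      rw [← hinv]
      field_simp
    have key : 2 * Real.log (((p.n * p.ℓ : ℕ) : ℝ) / p.β) * (1 / p.ε) ≤
        14 * ((1 + v) * Λ ^ 2 * t) := by
      calc 2 * Real.log (((p.n * p.ℓ : ℕ) : ℝ) / p.β) * (1 / p.ε)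
          ≤ 2 * (7 * (1 + v) * Λ * L) * (Λ * (t / L)) := by
            rw [hb]
            gcongr
            exact hB.trans (log_estimate hΛ hlogℓ hL)
        _ = 14 * ((1 + v) * Λ ^ 2 * t) := by
            field_simp
            ring
    have hle : (1 + v) * Λ ^ 2 * t ≤ (1 + v) * Λ ^ 3 * t := by
      gcongr
      · norm_num
    have h0 : 0 ≤ (1 + v) * Λ ^ 3 * t := by positivity
    calc p.ℓ * (2 * Real.log (((p.n * p.ℓ : ℕ) : ℝ) / p.β) * (1 / p.ε))
        ≤ p.ℓ * (113 * ((1 + v) * Λ ^ 3 * t)) := by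
          refine mul_le_mul_of_nonneg_left ?_ (Nat.cast_nonneg _)
          linarith
      _ = _ := by ring
  · have hL := hp.half_le_log hk
    set d := digits t + 1 with hd
    refine ⟨2 ^ (d + 1) * p.ℓ, Nat.mul_pos (by positivity) hp.ℓ, fun D ξ hξ y hy => ?_⟩
    refine (abs_rawAnswer_sub_le_of_tree hp.n D (by positivity) hξ hy).trans ?_
    have hdΛ : (d : ℝ) ≤ 2 * Λ := digits_succ_le ht0 ht
    have hround : (2 : ℝ) / 2 ^ d ≤ t := by
      refine le_trans (le_of_eq ?_) (digits_spec ht0)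
      rw [hd, pow_succ]
      field_simp
    have hB : Real.log (((2 ^ (d + 1) * p.ℓ : ℕ) : ℝ) / p.β) ≤ 3 * Λ + v + L := by
      have h1 : Real.log ((2 : ℝ) ^ (d + 1)) ≤ 3 * Λ := by
        rw [pow_succ, Real.log_mul (by positivity) two_ne_zero]
        have h2 := Real.log_le_log (by positivity) (two_pow_digits_succ_le ht0 ht)
        have h3 := Real.log_two_lt_d9
        linarith
      rw [Real.log_div (by rw [Nat.cast_mul]; positivity) hβ.ne', Nat.cast_mul, Nat.cast_pow, Nat.cast_ofNat,
        Real.log_mul (by positivity) hℓ0]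
      linarith
    have hB0 : 0 ≤ 2 * Real.log (((2 ^ (d + 1) * p.ℓ : ℕ) : ℝ) / p.β) := by
      refine mul_nonneg two_pos.le (Real.log_nonneg ((one_le_div hβ).2 (hp.β_lt.le.trans ?_)))
      exact_mod_cast Nat.mul_pos (by positivity) hp.ℓ
    have hc : (d : ℝ) * 2 / (p.n * p.ε) = d * 2 * (t / L) := by
      rw [← hinv]
      ring
    -- The three factors `Λ` come from the length of a path, the union bound and the noise scale;
    -- `112 = 2 * 14 * 4`, and rounding adds the last `1` of `113`.
    have key : d * (2 * Real.log (((2 ^ (d + 1) * p.ℓ : ℕ) : ℝ) / p.β)) *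
        ((d : ℝ) * 2 / (p.n * p.ε)) ≤ 112 * ((1 + v) * Λ ^ 3 * t) := by
      calc d * (2 * Real.log (((2 ^ (d + 1) * p.ℓ : ℕ) : ℝ) / p.β)) * ((d : ℝ) * 2 / (p.n * p.ε))
          ≤ (2 * Λ) * (2 * (7 * (1 + v) * Λ * L)) * ((2 * Λ) * 2 * (t / L)) := by
            rw [hc]
            gcongr
            exact hB.trans (log_estimate hΛ hlogℓ hL)
        _ = 112 * ((1 + v) * Λ ^ 3 * t) := by
            field_simp
            ring
    calc p.ℓ * (d * (2 * Real.log (((2 ^ (d + 1) * p.ℓ : ℕ) : ℝ) / p.β)) *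
          ((d : ℝ) * 2 / (p.n * p.ε)) + 2 / 2 ^ d)
        ≤ p.ℓ * (113 * ((1 + v) * Λ ^ 3 * t)) := by
          refine mul_le_mul_of_nonneg_left ?_ (Nat.cast_nonneg _)
          linarith
      _ = _ := by ring
  -- With `M = k = 1` the noise threshold is exactly `2 L`, so the error is `2 t` however small `L`
  -- is.
  · refine ⟨1, one_pos, fun D ξ hξ y _ => ?_⟩
    refine (abs_rawAnswer_sub_le_of_answer D (by positivity) (hξ 0 one_pos) y).trans ?_
    have hk1 : p.k = 1 := le_antisymm (not_lt.1 hk) hp.k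
    have hL1 : Real.log (((1 : ℕ) : ℝ) / p.β) = L := by rw [hLdef, hk1]
    rw [hinv, hL1]
    have h0 : 0 ≤ (1 + v) * Λ ^ 3 * t := by positivity
    have h1 : 2 * L * (t / L) = 2 * t := by field_simp
    rw [h1]
    nlinarith

end ReleaseParams.Valid

/-! ### Privacy and accuracy of the program. -/

namespace RamProgram

variable {p : ReleaseParams} {X : Set (L1Space p.ℓ)}

theorem isDifferentiallyPrivate_distanceQueryCode (hp : p.Valid) (hX : X ⊆ unitCube p.ℓ)
    (hdiam : Metric.diam X ≤ 1) (δ : ℝ) :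
    (distanceQueryCode.mechanism p).IsDifferentiallyPrivate tapeLaw X p.k p.ε δ := by
  refine isDifferentiallyPrivate_of_shift hp.n hp.ℓ p.ε δ fun D D' hD hD' hadj A => ?_
  have hdist : ∀ j, dist (D j) (D' j) ≤ 1 := fun j =>
    dist_le_one_of_diam hX hdiam (hD j) (hD' j)
  unfold ReleaseParams.tuning
  split_ifs with hk hlarge
  · obtain ⟨c, hc, h⟩ := exists_shift_data hp.n hp.ℓ hp.ε hadj hdist
    exact ⟨c, hc, fun _ _ _ ξ => h ξ _⟩
  · obtain ⟨c, hc, h⟩ := exists_shift_tree hp.n hp.ℓ (Nat.succ_pos (digits p.ratio)) hp.ε hadj hdist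
    exact ⟨c, hc, fun _ _ _ ξ => h ξ _⟩
  -- In a single round the query is fixed in advance by the analyst, so the shift may depend on it.
  · obtain ⟨c, hc, h⟩ := exists_shift_answer hp.n hp.ε hadj hdist (A.ask 0 Fin.elim0)
    refine ⟨c, hc, fun j hj b ξ => ?_⟩
    obtain rfl : j = 0 := by omega
    rw [Subsingleton.elim b Fin.elim0]
    exact h ξ

theorem isAccurate_distanceQueryCode (hp : p.Valid) (hX : X ⊆ unitCube p.ℓ)
    (hdiam : Metric.diam X ≤ 1) {α : ℝ}
    (hα : min 1 ((p.ℓ : ℝ) ^ (9 / 5 : ℝ) * p.ratio ^ (4 / 5 : ℝ)) * 5000000 ≤ α) :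
    (distanceQueryCode.mechanism p).IsAccurate tapeLaw X p.k α p.β := by
  have hℓ : (1 : ℝ) ≤ (p.ℓ : ℝ) ^ (9 / 5 : ℝ) :=
    Real.one_le_rpow (by exact_mod_cast hp.ℓ) (by norm_num)
  rcases le_or_gt p.ratio 1 with ht | ht
  · obtain ⟨M, hM, h⟩ := hp.exists_noise_bound ht
    refine isAccurate_of_noise_le hp.n hp.ℓ α hp.β hM fun D hD ξ hξ y hy => ?_
    refine (abs_clip_sub_le (distanceAnswer_mem_Icc hp.n hX hdiam hD hy)).trans (le_trans ?_ hα)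
    rcases min_cases 1 ((p.ℓ : ℝ) ^ (9 / 5 : ℝ) * p.ratio ^ (4 / 5 : ℝ)) with ⟨e, _⟩ | ⟨e, _⟩
    · rw [e]
      exact (min_le_left _ _).trans (by norm_num)
    · rw [e]
      refine (min_le_right _ _).trans ((h D ξ hξ y (hX hy)).trans ?_)
      -- The final constant comes from `113 * 40500 ≤ 5000000`.
      have h1 := errorScale_le hp.ℓ hp.ratio_pos ht
      have h2 : 0 ≤ (p.ℓ : ℝ) ^ (9 / 5 : ℝ) * p.ratio ^ (4 / 5 : ℝ) := by
        have := hp.ratio_pos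
        positivity
      linarith
  -- Now the claimed error exceeds `1`, so clipping suffices whatever the noise.
  · have h1 : (1 : ℝ) ≤ (p.ℓ : ℝ) ^ (9 / 5 : ℝ) * p.ratio ^ (4 / 5 : ℝ) :=
      one_le_mul_of_one_le_of_one_le hℓ (Real.one_le_rpow ht.le (by norm_num))
    rw [min_eq_left h1] at hα
    refine isAccurate_of_noise_le hp.n hp.ℓ α hp.β one_pos fun D hD ξ _ y hy => ?_
    refine (abs_clip_sub_le (distanceAnswer_mem_Icc hp.n hX hdiam hD hy)).trans
      ((min_le_left _ _).trans (le_trans (by norm_num) hα))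

end RamProgram

/-! ### The two parts of the theorem. -/

theorem mainTheorem1 :
    (∃ (P : RamProgram) (C : ℝ) (K : ℕ), 0 < C ∧
      ∀ (n ℓ k : ℕ) (ε δ β : ℝ), 1 ≤ n → 1 ≤ ℓ → 1 ≤ k →
        0 < ε → 0 < δ → δ < 1 → 0 < β → β < 1 →
        ∀ X : Set (L1Space ℓ), X ⊆ unitCube ℓ → Metric.diam X ≤ 1 →
          (P.mechanism ⟨n, ℓ, k, ε, δ, β⟩).IsDifferentiallyPrivate tapeLaw X k ε δ ∧
          (P.mechanism ⟨n, ℓ, k, ε, δ, β⟩).IsAccurate tapeLaw X k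
            (C * ((ℓ : ℝ) ^ (9 / 5 : ℝ) * Real.log (4 / δ) ^ (4 / 5 : ℝ) *
                Real.log (k / β) ^ (4 / 5 : ℝ) /
              ((n : ℝ) ^ (4 / 5 : ℝ) * ε ^ (4 / 5 : ℝ)))) β ∧
          P.AnswersInTime ⟨n, ℓ, k, ε, δ, β⟩ X (K * (ℓ * n))) ∧
    (∃ (P : RamProgram) (C : ℝ) (K : ℕ), 0 < C ∧
      ∀ (n ℓ k : ℕ) (ε β : ℝ), 1 ≤ n → 1 ≤ ℓ → 1 ≤ k →
        0 < ε → 0 < β → β < 1 →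
        ∀ X : Set (L1Space ℓ), X ⊆ unitCube ℓ → Metric.diam X ≤ 1 →
          (P.mechanism ⟨n, ℓ, k, ε, 0, β⟩).IsDifferentiallyPrivate tapeLaw X k ε 0 ∧
          (P.mechanism ⟨n, ℓ, k, ε, 0, β⟩).IsAccurate tapeLaw X k
            (C * ((ℓ : ℝ) ^ (7 / 3 : ℝ) * Real.log (k / β) ^ (2 / 3 : ℝ) /
              ((n : ℝ) ^ (2 / 3 : ℝ) * ε ^ (2 / 3 : ℝ)))) β ∧
          P.AnswersInTime ⟨n, ℓ, k, ε, 0, β⟩ X (K * (ℓ * n))) := by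
  refine ⟨⟨RamProgram.distanceQueryCode, 5000000, 250, by norm_num, ?_⟩,
    ⟨RamProgram.distanceQueryCode, 5000000, 250, by norm_num, ?_⟩⟩
  · intro n ℓ k ε δ β hn hℓ hk hε hδ hδ1 hβ hβ1 X hX hdiam
    have hp : (⟨n, ℓ, k, ε, δ, β⟩ : ReleaseParams).Valid := ⟨hn, hℓ, hk, hε, hβ, hβ1⟩
    refine ⟨RamProgram.isDifferentiallyPrivate_distanceQueryCode hp hX hdiam δ,
      RamProgram.isAccurate_distanceQueryCode hp hX hdiam ?_, RamProgram.answersInTime hn hℓ⟩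
    have hL := hp.log_pos.le
    have hδL : 1 ≤ Real.log (4 / δ) ^ (4 / 5 : ℝ) :=
      Real.one_le_rpow (one_le_log_four_div hδ hδ1.le) (by norm_num)
    have e : (⟨n, ℓ, k, ε, δ, β⟩ : ReleaseParams).ratio ^ (4 / 5 : ℝ) =
        Real.log (k / β) ^ (4 / 5 : ℝ) / ((n : ℝ) ^ (4 / 5 : ℝ) * ε ^ (4 / 5 : ℝ)) := by
      rw [ReleaseParams.ratio, Real.div_rpow hL (by positivity),
        Real.mul_rpow (by positivity) hε.le]
    have h0 : 0 ≤ (ℓ : ℝ) ^ (9 / 5 : ℝ) *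
        (⟨n, ℓ, k, ε, δ, β⟩ : ReleaseParams).ratio ^ (4 / 5 : ℝ) := by
      have := hp.ratio_pos
      positivity
    rw [mul_comm]
    refine mul_le_mul_of_nonneg_left ((min_le_right _ _).trans
      ((le_mul_of_one_le_right h0 hδL).trans (le_of_eq ?_))) (by norm_num)
    rw [e]
    ring
  · intro n ℓ k ε β hn hℓ hk hε hβ hβ1 X hX hdiam
    have hp : (⟨n, ℓ, k, ε, 0, β⟩ : ReleaseParams).Valid := ⟨hn, hℓ, hk, hε, hβ, hβ1⟩
    refine ⟨RamProgram.isDifferentiallyPrivate_distanceQueryCode hp hX hdiam 0,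
      RamProgram.isAccurate_distanceQueryCode hp hX hdiam ?_, RamProgram.answersInTime hn hℓ⟩
    have hL := hp.log_pos.le
    have e : (⟨n, ℓ, k, ε, 0, β⟩ : ReleaseParams).ratio ^ (2 / 3 : ℝ) =
        Real.log (k / β) ^ (2 / 3 : ℝ) / ((n : ℝ) ^ (2 / 3 : ℝ) * ε ^ (2 / 3 : ℝ)) := by
      rw [ReleaseParams.ratio, Real.div_rpow hL (by positivity),
        Real.mul_rpow (by positivity) hε.le]
    have hℓ' : (1 : ℝ) ≤ ℓ := by exact_mod_cast hℓ
    have ht0 := hp.ratio_pos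
    rw [mul_comm, mul_div_assoc, ← e]
    refine mul_le_mul_of_nonneg_left ?_ (by norm_num)
    rcases le_total (⟨n, ℓ, k, ε, 0, β⟩ : ReleaseParams).ratio 1 with ht | ht
    · refine (min_le_right _ _).trans (mul_le_mul ?_ ?_ (by positivity) (by positivity))
      · exact Real.rpow_le_rpow_of_exponent_le hℓ' (by norm_num)
      · exact Real.rpow_le_rpow_of_exponent_ge ht0 ht (by norm_num)
    · exact (min_le_left _ _).trans (one_le_mul_of_one_le_of_one_le
        (Real.one_le_rpow hℓ' (by norm_num)) (Real.one_le_rpow ht (by norm_num)))
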